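/- All graphs are finite and simple. A multiset $\mathscr{P}$ of paths in a graph $G$ is a \emph{$2$-rainbow separating path system} of $G$ if its elements can be colored with $2$ colors so that for every two distinct edges $e_1,e_2$ of $G$ there exist paths $P_1,P_2\in\mathscr{P}$ of distinct colors such that $P_1$ contains $e_1$ but not $e_2$, and $P_2$ contains $e_2$ but not $e_1$. Let $c_2(G)$ denote the smallest cardinality (counted with multiplicity) of a $2$-rainbow separating path system of $G$. Theorem. Let $T$ be a tree with $n\ge 2$ vertices. Then \[ c_2(T)\le \frac{4(n-1)}{3}. \] -/

import Mathlib

/-- The subgraph `H` of `G` is a path of `G`, that is, the subgraph traced by a walk without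
repeated vertices. -/
def SimpleGraph.Subgraph.IsPathOf {V : Type*} {G : SimpleGraph V} (H : G.Subgraph) : Prop :=
  ∃ (u v : V) (p : G.Walk u v), p.IsPath ∧ p.toSubgraph = H

/-- `P` is a `k`-rainbow separating path system of `G`: a multiset of paths of `G` whose elements
can be coloured with `k` colours (different copies of the same path may get different colours)
so that any two distinct edges `e₁`, `e₂` are separated by two paths of distinct colours, one of
which contains `e₁` but not `e₂` and the other `e₂` but not `e₁`. The multiset `Q` below is `P`
together with such a colouring. -/
def SimpleGraph.IsRainbowSeparating {V : Type*} (G : SimpleGraph V) (k : ℕ)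
    (P : Multiset G.Subgraph) : Prop :=
  (∀ H ∈ P, H.IsPathOf) ∧
    ∃ Q : Multiset (G.Subgraph × Fin k), Q.map Prod.fst = P ∧
      ∀ e₁ ∈ G.edgeSet, ∀ e₂ ∈ G.edgeSet, e₁ ≠ e₂ →
        ∃ x ∈ Q, ∃ y ∈ Q, x.2 ≠ y.2 ∧
          (e₁ ∈ x.1.edgeSet ∧ e₂ ∉ x.1.edgeSet) ∧ (e₂ ∈ y.1.edgeSet ∧ e₁ ∉ y.1.edgeSet)

/-- The `k`-rainbow separation number `c_k(G)`: the smallest cardinality (with multiplicity) of a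
`k`-rainbow separating path system of `G`; it is `⊤` if there is no finite one. -/
noncomputable def SimpleGraph.rainbowSeparationNumber {V : Type*} (G : SimpleGraph V) (k : ℕ) :
    ℕ∞ :=
  ⨅ (P : Multiset G.Subgraph) (_ : G.IsRainbowSeparating k P), (P.card : ℕ∞)

/-!
Root `T` at a leaf, so that every edge is determined by its lower endpoint. Call a separating system
*bichromatic* if every edge lies on paths of both colours. A bichromatic system and a covering
system on disjoint sets of edges together form a covering system. A bichromatic system can also be
grown downwards: if distinct paths `J v` end at the vertices `v` at its lower boundary, and every
edge lies on a further path of the colour of `J v`, then attaching one or two edges below `v` costs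
one new path per new edge.

Let `v` be a deepest vertex with at least three children. Then three or four of the branches at `v`,
or all of them and the edge above `v`, have a bichromatic system, grown from a star, with at most
`4/3` paths per edge; remove them and use induction. The exception is a vertex `v` below which hang
just two single edges and a path of two edges: these four edges cost five paths, and for that a
path through the edge above `v` in the system of the remaining tree has to be prolonged or replaced.
If no vertex has three children, then growing from three copies of the edge at the root gives a
system with two paths more than edges, which is good enough from six edges on.
-/

namespace RainbowTree

variable {V : Type*} {T : SimpleGraph V}

/-- A rooting of `T`. The edges of `T` are encoded by their lower endpoints: the vertex
`x ≠ root` stands for the edge between `x` and `parent x`. -/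
structure Rooting (T : SimpleGraph V) where
  root : V
  parent : V → V
  depth : V → ℕ
  parent_root : parent root = root
  adj_parent : ∀ x ≠ root, T.Adj (parent x) x
  depth_parent_lt : ∀ x ≠ root, depth (parent x) < depth x
  exists_eq_of_mem_edgeSet : ∀ e ∈ T.edgeSet, ∃ x ≠ root, s(parent x, x) = e

theorem exists_adj_dist_lt (hT : T.Connected) {r x : V} (hx : x ≠ r) :
    ∃ y, T.Adj y x ∧ T.dist r y < T.dist r x := by
  obtain ⟨p, hp⟩ := hT.exists_walk_length_eq_dist x r
  cases p with
  | nil => exact absurd rfl hx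
  | @cons _ y _ h q =>
    refine ⟨y, h.symm, ?_⟩
    rw [SimpleGraph.dist_comm, SimpleGraph.dist_comm (u := r), ← hp, SimpleGraph.Walk.length_cons]
    exact Nat.lt_succ_of_le (SimpleGraph.dist_le q)

theorem eq_of_edge_eq_of_depth_lt {parent : V → V} {depth : V → ℕ} {x y : V}
    (hx : depth (parent x) < depth x) (hy : depth (parent y) < depth y)
    (h : s(parent x, x) = s(parent y, y)) : x = y := by
  rcases Sym2.eq_iff.1 h with ⟨-, h⟩ | ⟨h₁, h₂⟩
  · exact h
  · rw [h₁] at hx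
    rw [← h₂] at hy
    exact absurd hx hy.not_gt

theorem exists_rooting [Finite V] (hT : T.IsTree) (r : V) : ∃ R : Rooting T, R.root = r := by
  classical
  have := Fintype.ofFinite V
  have hparent : ∀ x, ∃ y, (x = r → y = r) ∧ (x ≠ r → T.Adj y x ∧ T.dist r y < T.dist r x) := by
    intro x
    by_cases hx : x = r
    · exact ⟨r, fun _ => rfl, fun h => absurd hx h⟩
    · obtain ⟨y, hy⟩ := exists_adj_dist_lt hT.connected hx
      exact ⟨y, fun h => absurd h hx, fun _ => hy⟩
  choose parent hroot hlt using hparent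
  have himage : (Finset.univ.erase r).image (fun x => s(parent x, x)) = T.edgeFinset := by
    refine Finset.eq_of_subset_of_card_le ?_ ?_
    · intro e he
      obtain ⟨x, hx, rfl⟩ := Finset.mem_image.1 he
      exact SimpleGraph.mem_edgeFinset.2 (hlt x (Finset.ne_of_mem_erase hx)).1
    · rw [Finset.card_image_of_injOn, Finset.card_erase_of_mem (Finset.mem_univ r),
        Finset.card_univ, ← hT.card_edgeFinset, Nat.add_sub_cancel]
      exact fun x hx y hy => eq_of_edge_eq_of_depth_lt
        (hlt x (Finset.ne_of_mem_erase hx)).2 (hlt y (Finset.ne_of_mem_erase hy)).2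
  refine ⟨⟨r, parent, T.dist r, hroot r rfl, fun x hx => (hlt x hx).1, fun x hx => (hlt x hx).2,
    fun e he => ?_⟩, rfl⟩
  rw [← SimpleGraph.mem_edgeFinset, ← himage, Finset.mem_image] at he
  obtain ⟨x, hx, he⟩ := he
  exact ⟨x, Finset.ne_of_mem_erase hx, he⟩

theorem eq_endpoint_of_unique_edge {v w : V} :
    ∀ {u t : V} (p : T.Walk u t), p.IsPath → v ∈ p.support →
      (∀ w', s(w', v) ∈ p.edges → w' = w) → v = u ∨ v = t
  | _, _, .nil, _, hv, _ => by simpa using hv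
  | u, t, .cons (v := x) h q, hp, hv, hw => by
    rw [SimpleGraph.Walk.cons_isPath_iff] at hp
    rw [SimpleGraph.Walk.support_cons, List.mem_cons] at hv
    rcases hv with rfl | hv
    · exact Or.inl rfl
    rcases eq_endpoint_of_unique_edge q hp.1 hv (fun w' h' => hw w' (by simp [h'])) with rfl | h'
    · cases q with
      | nil => exact Or.inr rfl
      | @cons _ y _ h' q' =>
        have hu : u = w := hw u (by simp)
        have hy : y = w := hw y (by simp [Sym2.eq_swap (a := y)])
        subst hu hy
        exact absurd (by simp) hp.2
    · exact Or.inr h'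

namespace Rooting

variable (R : Rooting T)

/-- The edge of `T` encoded by the vertex `x`; a junk value if `x` is the root. -/
def edge (x : V) : Sym2 V := s(R.parent x, x)

variable {R} in
theorem edge_injOn : Set.InjOn R.edge {x | x ≠ R.root} := fun x hx y hy =>
  eq_of_edge_eq_of_depth_lt (R.depth_parent_lt x hx) (R.depth_parent_lt y hy)

/-- `A` encodes the edge set of a path of `T`. -/
def IsPathSet (A : Finset V) : Prop :=
  R.root ∉ A ∧ ∃ (u v : V) (p : T.Walk u v), p.IsPath ∧ ∀ e, e ∈ p.edges ↔ ∃ x ∈ A, R.edge x = e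

variable {R}

theorem isPathSet_singleton {x : V} (hx : x ≠ R.root) : R.IsPathSet {x} :=
  ⟨by simpa using hx.symm, R.parent x, x, .cons (R.adj_parent x hx) .nil,
    by simp [(R.adj_parent x hx).ne], by simp [edge, eq_comm]⟩

variable [DecidableEq V]

theorem isPathSet_pair_of_parent_eq {x y : V} (hx : x ≠ R.root) (hy : y ≠ R.root) (hxy : x ≠ y)
    (h : R.parent x = R.parent y) : R.IsPathSet {x, y} := by
  have hadj : T.Adj (R.parent x) y := h ▸ R.adj_parent y hy
  refine ⟨by simp [hx.symm, hy.symm], x, y,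
    .cons (R.adj_parent x hx).symm (.cons hadj .nil),
    by simp [(R.adj_parent x hx).ne', hadj.ne, hxy], fun e => ?_⟩
  simp [edge, h, Sym2.eq_swap (a := x), eq_comm (a := e)]

/-- If no child of `v` lies in `A`, then `v` is an endpoint of the path encoded by `A`, which can
therefore be prolonged from `v`. -/
theorem IsPathSet.insert_child {A : Finset V} {l : V} (hA : R.IsPathSet A) (hl : l ≠ R.root)
    (hlA : R.parent l ∈ A) (hchild : ∀ y ∈ A, R.parent y ≠ R.parent l)
    (hparent : ∀ y ∈ A, R.parent y ≠ l) : R.IsPathSet (insert l A) := by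
  obtain ⟨hroot, u, t, p, hp, hpA⟩ := hA
  refine ⟨by simp [hl.symm, hroot], ?_⟩
  have hadj := R.adj_parent l hl
  set v := R.parent l
  have hunique : ∀ w, s(w, v) ∈ p.edges → w = R.parent v := by
    intro w hw
    obtain ⟨y, hy, hyw⟩ := (hpA _).1 hw
    rcases Sym2.eq_iff.1 hyw with ⟨h, h'⟩ | ⟨h, -⟩
    · rw [← h, h']
    · exact absurd h (hchild y hy)
  have hedge : R.edge v ∈ p.edges := (hpA _).2 ⟨v, hlA, rfl⟩
  have hv : v ∈ p.support := p.snd_mem_support_of_mem_edges hedge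
  have hlp : l ∉ p.support := by
    intro hlp
    have hnil : ¬ p.Nil := SimpleGraph.Walk.edges_eq_nil.not.1 (List.ne_nil_of_mem hedge)
    obtain ⟨e, he, hle⟩ := (SimpleGraph.Walk.mem_support_iff_exists_mem_edges_of_not_nil hnil).1 hlp
    obtain ⟨y, hy, rfl⟩ := (hpA e).1 he
    rcases Sym2.mem_iff.1 hle with h | rfl
    · exact hparent y hy h.symm
    · exact hchild l hy rfl
  rcases eq_endpoint_of_unique_edge p hp hv hunique with rfl | rfl
  · exact ⟨l, t, .cons hadj.symm p, hp.cons hlp, fun e => by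
      simp [hpA, edge, v, Sym2.eq_swap (a := l), eq_comm (a := e)]⟩
  · exact ⟨u, l, p.concat hadj, hp.concat hlp hadj, fun e => by
      simp [hpA, edge, v, or_comm, eq_comm (a := e)]⟩

theorem isPathSet_pair_parent {x : V} (hx : x ≠ R.root) (hpx : R.parent x ≠ R.root) :
    R.IsPathSet {x, R.parent x} := by
  have hlt := R.depth_parent_lt x hx
  have hlt' := R.depth_parent_lt (R.parent x) hpx
  refine (isPathSet_singleton hpx).insert_child hx (by simp) ?_ ?_
  · simp only [Finset.mem_singleton, forall_eq]
    exact fun h => hlt'.ne (by rw [h])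
  · simp only [Finset.mem_singleton, forall_eq]
    exact fun h => (hlt'.trans hlt).ne (by rw [h])

variable (R) in
/-- The vertices of `s` encode edges of `T` with a common endpoint. -/
def IsStar (s : Finset V) : Prop := ∃ v, ∀ x ∈ s, x ≠ R.root ∧ (x = v ∨ R.parent x = v)

theorem IsStar.isPathSet_pair {s : Finset V} (hs : R.IsStar s) {x y : V} (hx : x ∈ s)
    (hy : y ∈ s) : R.IsPathSet {x, y} := by
  obtain ⟨v, hv⟩ := hs
  obtain ⟨hx₀, hxv⟩ := hv x hx
  obtain ⟨hy₀, hyv⟩ := hv y hy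
  rcases eq_or_ne x y with rfl | hxy
  · simpa using isPathSet_singleton hx₀
  rcases hxv with rfl | rfl
  · rcases hyv with rfl | hyv
    · exact absurd rfl hxy
    · subst hyv
      exact Finset.pair_comm y _ ▸ isPathSet_pair_parent hy₀ hx₀
  · rcases hyv with rfl | hyv
    · exact isPathSet_pair_parent hx₀ hy₀
    · exact isPathSet_pair_of_parent_eq hx₀ hy₀ hxy hyv.symm

end Rooting

/-- A finite family of paths with edges in `E`, coloured with two colours, that separates the edges
of `E` in the rainbow sense. -/
structure System (R : Rooting T) (E : Finset V) (ι : Type) where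
  path : ι → Finset V
  color : ι → Bool
  isPathSet : ∀ i, R.IsPathSet (path i)
  path_subset : ∀ i, path i ⊆ E
  separates : ∀ e ∈ E, ∀ f ∈ E, e ≠ f → ∃ i j, color i ≠ color j ∧
    (e ∈ path i ∧ f ∉ path i) ∧ (f ∈ path j ∧ e ∉ path j)

/-- A family of `n` subsets of `Fin m`, coloured with two colours, that separates `Fin m` in the
rainbow sense: the blueprint of a system of `n` paths on `m` edges. -/
structure Design (m n : ℕ) where
  path : Fin n → Finset (Fin m)
  color : Fin n → Bool
  separates : ∀ e f, e ≠ f → ∃ i j, color i ≠ color j ∧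
    (e ∈ path i ∧ f ∉ path i) ∧ (f ∈ path j ∧ e ∉ path j)

namespace System

variable {R : Rooting T} {E F : Finset V} {ι κ : Type}

/-- The edge `e` lies on a path of colour `b`. -/
def Has (S : System R E ι) (b : Bool) (e : V) : Prop := ∃ i, S.color i = b ∧ e ∈ S.path i

/-- Every edge lies on some path. -/
def IsCovering (S : System R E ι) : Prop := ∀ e ∈ E, ∃ b, S.Has b e

/-- Every edge lies on paths of both colours. -/
def IsBichromatic (S : System R E ι) : Prop := ∀ e ∈ E, ∀ b, S.Has b e

/-- The system with edges `y e` in which the path `k` consists of the `y e` with `e ∈ d.path k`. -/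
def ofDesign {m n : ℕ} (d : Design m n) (y : Fin m ↪ V)
    (hpath : ∀ k, R.IsPathSet ((d.path k).map y)) : System R (Finset.univ.map y) (Fin n) where
  path k := (d.path k).map y
  color := d.color
  isPathSet := hpath
  path_subset k := Finset.map_subset_map.2 (Finset.subset_univ _)
  separates := by
    simpa only [Finset.mem_map, Finset.mem_univ, true_and, forall_exists_index,
      forall_apply_eq_imp_iff, ne_eq, y.injective.eq_iff, exists_eq_right] using d.separates

variable [DecidableEq V]

/-- Prolong the paths of `S` by the new edges `X i`, and add the paths `N k` consisting of new edges
only. -/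
@[simps]
def extend (S : System R E ι) (F : Finset V) (X : ι → Finset V) (N : κ → Finset V) (c : κ → Bool)
    (hEF : Disjoint E F) (hX : ∀ i, X i ⊆ F) (hN : ∀ k, N k ⊆ F)
    (hXpath : ∀ i, R.IsPathSet (S.path i ∪ X i)) (hNpath : ∀ k, R.IsPathSet (N k))
    (hFE : ∀ e ∈ F, ∀ f ∈ E, ∃ k i, c k ≠ S.color i ∧ e ∈ N k ∧ f ∈ S.path i ∧ e ∉ X i)
    (hFF : ∀ e ∈ F, ∀ f ∈ F, e ≠ f → ∃ i j,
      Sum.elim S.color c i ≠ Sum.elim S.color c j ∧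
        (e ∈ Sum.elim X N i ∧ f ∉ Sum.elim X N i) ∧ (f ∈ Sum.elim X N j ∧ e ∉ Sum.elim X N j)) :
    System R (E ∪ F) (ι ⊕ κ) where
  path := Sum.elim (fun i => S.path i ∪ X i) N
  color := Sum.elim S.color c
  isPathSet := Sum.rec hXpath hNpath
  path_subset := Sum.rec (fun i => Finset.union_subset_union (S.path_subset i) (hX i))
    fun k => (hN k).trans Finset.subset_union_right
  separates := by
    have hE : ∀ e ∈ E, e ∉ F := fun e he => Finset.disjoint_left.1 hEF he
    have hXE : ∀ i, ∀ e ∈ E, e ∉ X i := fun i e he h => hE e he (hX i h)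
    have hNE : ∀ k, ∀ e ∈ E, e ∉ N k := fun k e he h => hE e he (hN k h)
    have hSF : ∀ i, ∀ e ∈ F, e ∉ S.path i := fun i e he h => hE e (S.path_subset i h) he
    intro e he f hf hef
    rcases Finset.mem_union.1 he with he | he <;> rcases Finset.mem_union.1 hf with hf | hf
    · obtain ⟨i, j, hc, hi, hj⟩ := S.separates e he f hf hef
      exact ⟨.inl i, .inl j, hc, by simp [hi, hXE i f hf], by simp [hj, hXE j e he]⟩
    · obtain ⟨k, i, hc, hfk, hei, hfi⟩ := hFE f hf e he
      exact ⟨.inl i, .inr k, hc.symm, by simp [hei, hfi, hSF i f hf], hfk, hNE k e he⟩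
    · obtain ⟨k, i, hc, hek, hfi, hei⟩ := hFE e he f hf
      exact ⟨.inr k, .inl i, hc, ⟨hek, hNE k f hf⟩, by simp [hfi, hei, hSF i e he]⟩
    · have hmem : ∀ g ∈ F, ∀ i, g ∈ Sum.elim (fun i => S.path i ∪ X i) N i ↔
          g ∈ Sum.elim X N i := by
        rintro g hg (i | k)
        · simp [hSF i g hg]
        · rfl
      simp only [hmem e he, hmem f hf]
      exact hFF e he f hf hef

/-- Juxtapose two systems on disjoint edge sets. -/
def union (S₁ : System R E ι) (S₂ : System R F κ) (hEF : Disjoint E F)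
    (hcolor : ∀ e ∈ E, ∀ f ∈ F, ∃ b, S₁.Has b e ∧ S₂.Has (!b) f) : System R (E ∪ F) (ι ⊕ κ) :=
  S₁.extend F (fun _ => ∅) S₂.path S₂.color hEF (fun _ => Finset.empty_subset _) S₂.path_subset
    (fun i => by simpa using S₁.isPathSet i) S₂.isPathSet
    (fun f hf e he => by
      obtain ⟨b, ⟨i, hi, hei⟩, k, hk, hfk⟩ := hcolor e he f hf
      exact ⟨k, i, by simp [hi, hk], hfk, hei, Finset.notMem_empty f⟩)
    (fun e he f hf hef => by
      obtain ⟨i, j, hc, hi, hj⟩ := S₂.separates e he f hf hef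
      exact ⟨.inr i, .inr j, hc, hi, hj⟩)

theorem IsCovering.union {S₁ : System R E ι} {S₂ : System R F κ} (h₁ : S₁.IsCovering)
    (h₂ : S₂.IsCovering) (hEF : Disjoint E F)
    (hcolor : ∀ e ∈ E, ∀ f ∈ F, ∃ b, S₁.Has b e ∧ S₂.Has (!b) f) :
    (S₁.union S₂ hEF hcolor).IsCovering := by
  intro e he
  rcases Finset.mem_union.1 he with he | he
  · obtain ⟨b, i, hi, hei⟩ := h₁ e he
    exact ⟨b, .inl i, hi, Finset.mem_union_left _ hei⟩
  · obtain ⟨b, i, hi, hei⟩ := h₂ e he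
    exact ⟨b, .inr i, hi, hei⟩

end System

namespace Rooting

variable {R : Rooting T} {E F : Finset V} {m n : ℕ}

variable (R) in
/-- The edges of `E` have a covering separating system of `n` paths. -/
def HasCovering (E : Finset V) (n : ℕ) : Prop :=
  ∃ (ι : Type) (_ : Fintype ι) (S : System R E ι), Fintype.card ι = n ∧ S.IsCovering

variable (R) in
/-- The edges of `E` have a bichromatic separating system of `n` paths. -/
def HasBichromatic (E : Finset V) (n : ℕ) : Prop :=
  ∃ (ι : Type) (_ : Fintype ι) (S : System R E ι), Fintype.card ι = n ∧ S.IsBichromatic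

theorem HasBichromatic.hasCovering (h : R.HasBichromatic E n) : R.HasCovering E n := by
  obtain ⟨ι, _, S, hn, hS⟩ := h
  exact ⟨ι, _, S, hn, fun e he => ⟨true, hS e he true⟩⟩

theorem HasCovering.union [DecidableEq V] (hE : R.HasCovering E m) (hF : R.HasBichromatic F n)
    (hEF : Disjoint E F) : R.HasCovering (E ∪ F) (m + n) := by
  obtain ⟨ι, _, S₁, rfl, h₁⟩ := hE
  obtain ⟨κ, _, S₂, rfl, h₂⟩ := hF
  have hcolor : ∀ e ∈ E, ∀ f ∈ F, ∃ b, S₁.Has b e ∧ S₂.Has (!b) f := fun e he f hf =>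
    (h₁ e he).imp fun b hb => ⟨hb, h₂ f hf _⟩
  exact ⟨ι ⊕ κ, inferInstance, S₁.union S₂ hEF hcolor, Fintype.card_sum,
    h₁.union (fun f hf => ⟨true, h₂ f hf true⟩) hEF hcolor⟩

variable [DecidableEq V]

variable (R) in
/-- The children of `x` in `U`. -/
def children (U : Finset V) (x : V) : Finset V := U.filter (R.parent · = x)

theorem mem_children {U : Finset V} {x y : V} :
    y ∈ R.children U x ↔ y ∈ U ∧ R.parent y = x := Finset.mem_filter

variable (R) in
/-- The vertices of `S` with a child in `W` outside `S`. -/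
def frontier (W S : Finset V) : Finset V := S.filter fun x => (R.children (W \ S) x).Nonempty

theorem mem_frontier {W S : Finset V} {x : V} :
    x ∈ R.frontier W S ↔ x ∈ S ∧ ∃ y ∈ W, y ∉ S ∧ R.parent y = x := by
  simp [frontier, Finset.Nonempty, mem_children, and_assoc]

/-- `W` arises from `S` by repeatedly attaching children. -/
structure IsGrowable (R : Rooting T) (W S : Finset V) : Prop where
  root_notMem : R.root ∉ W
  subset : S ⊆ W
  parent_mem_of_notMem : ∀ x ∈ W, x ∉ S → R.parent x ∈ W
  parent_mem_of_mem : ∀ x ∈ S, R.parent x ∈ W → R.parent x ∈ S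

theorem IsGrowable.nonempty_frontier {W S : Finset V} (h : R.IsGrowable W S) (hne : S ≠ W) :
    (R.frontier W S).Nonempty := by
  have hdiff : (W \ S).Nonempty := Finset.sdiff_nonempty.2 fun h' => hne (h.subset.antisymm h')
  obtain ⟨y, hy, hmin⟩ := Finset.exists_min_image (W \ S) R.depth hdiff
  obtain ⟨hyW, hyS⟩ := Finset.mem_sdiff.1 hy
  have hlt := R.depth_parent_lt y fun h' => h.root_notMem (h' ▸ hyW)
  have hparent : R.parent y ∈ S := by
    by_contra h'
    exact hlt.not_ge (hmin _ (Finset.mem_sdiff.2 ⟨h.parent_mem_of_notMem y hyW hyS, h'⟩))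
  exact ⟨R.parent y, mem_frontier.2 ⟨hparent, y, hyW, hyS, rfl⟩⟩

theorem IsGrowable.union_children {W S : Finset V} (h : R.IsGrowable W S) {v : V} (hv : v ∈ S) :
    R.IsGrowable W (S ∪ R.children (W \ S) v) where
  root_notMem := h.root_notMem
  subset := Finset.union_subset h.subset
    ((Finset.filter_subset _ _).trans Finset.sdiff_subset)
  parent_mem_of_notMem x hx hxS :=
    h.parent_mem_of_notMem x hx fun h' => hxS (Finset.mem_union_left _ h')
  parent_mem_of_mem x hx hpx := by
    refine Finset.mem_union_left _ ?_
    rcases Finset.mem_union.1 hx with hx | hx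
    · exact h.parent_mem_of_mem x hx hpx
    · rwa [(mem_children.1 hx).2]

end Rooting

/-- A bichromatic system on `S` that can be prolonged to a bichromatic system on `W`: to every
vertex `v` of the frontier belongs a path `J v` through `v` that ends there, and every edge lies on
a further path of the colour of `J v`. -/
structure Growing {R : Rooting T} {ι : Type} [DecidableEq V] (W S : Finset V) (Q : System R S ι)
    (J : V → ι) : Prop where
  isBichromatic : Q.IsBichromatic
  injOn : Set.InjOn J (R.frontier W S)
  mem_path : ∀ v ∈ R.frontier W S, v ∈ Q.path (J v)
  parent_ne : ∀ v ∈ R.frontier W S, ∀ x ∈ S, R.parent x ≠ v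
  spare : ∀ v ∈ R.frontier W S, ∀ f ∈ S, ∃ i ≠ J v, Q.color i = Q.color (J v) ∧ f ∈ Q.path i

namespace Growing

open Rooting

variable [DecidableEq V] {R : Rooting T} {W S F : Finset V} {ι κ : Type} {Q : System R S ι}
  {J : V → ι} {v : V}

/-- The children of `v` become the new frontier vertices in place of `v`. -/
theorem union_children (hQ : Growing W S Q J) (hS : R.IsGrowable W S) (hv : v ∈ S)
    (hF : R.children (W \ S) v = F) (Q' : System R (S ∪ F) (ι ⊕ κ)) (J' : V → ι ⊕ κ)
    (hcolor : ∀ i, Q'.color (.inl i) = Q.color i) (hpath : ∀ i, Q.path i ⊆ Q'.path (.inl i))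
    (hmem : ∀ f ∈ F, ∀ b, ∃ i, Q'.color i = b ∧ f ∈ Q'.path i ∧
      ∀ u ∈ R.frontier W S, u ≠ v → i ≠ .inl (J u))
    (hinj : Set.InjOn J' F)
    (hne : ∀ f ∈ F, ∀ u ∈ R.frontier W S, u ≠ v → J' f ≠ .inl (J u))
    (hmem' : ∀ f ∈ F, f ∈ Q'.path (J' f))
    (hspare : ∀ l ∈ F, ∀ f ∈ S ∪ F, ∃ i ≠ J' l, Q'.color i = Q'.color (J' l) ∧ f ∈ Q'.path i) :
    Growing W (S ∪ F) Q' fun u => if u ∈ F then J' u else .inl (J u) := by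
  have mem_F : ∀ f, f ∈ F ↔ (f ∈ W ∧ f ∉ S) ∧ R.parent f = v := by
    simp [← hF, mem_children]
  have hold : ∀ u ∈ R.frontier W (S ∪ F), u ∉ F → u ∈ R.frontier W S ∧ u ≠ v := by
    intro u hu huF
    obtain ⟨huS, y, hyW, hy, rfl⟩ := mem_frontier.1 hu
    rw [Finset.notMem_union] at hy
    refine ⟨mem_frontier.2 ⟨(Finset.mem_union.1 huS).resolve_right huF, y, hyW, hy.1, rfl⟩, ?_⟩
    exact fun h => hy.2 ((mem_F y).2 ⟨⟨hyW, hy.1⟩, h⟩)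
  refine ⟨fun e he b => ?_, fun u hu w hw huw => ?_, fun u hu => ?_, fun u hu x hx hxu => ?_,
    fun u hu f hf => ?_⟩
  · rcases Finset.mem_union.1 he with he | he
    · obtain ⟨i, hi, hei⟩ := hQ.isBichromatic e he b
      exact ⟨.inl i, (hcolor i).trans hi, hpath i hei⟩
    · obtain ⟨i, hi, hei, -⟩ := hmem e he b
      exact ⟨i, hi, hei⟩
  · by_cases huF : u ∈ F <;> by_cases hwF : w ∈ F <;> simp only [huF, hwF, if_true, if_false] at huw
    · exact hinj huF hwF huw
    · exact absurd huw (hne u huF w (hold w hw hwF).1 (hold w hw hwF).2)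
    · exact absurd huw.symm (hne w hwF u (hold u hu huF).1 (hold u hu huF).2)
    · exact hQ.injOn (hold u hu huF).1 (hold w hw hwF).1 (Sum.inl_injective huw)
  · by_cases huF : u ∈ F <;> simp only [huF, if_true, if_false]
    · exact hmem' u huF
    · exact hpath _ (hQ.mem_path u (hold u hu huF).1)
  · by_cases huF : u ∈ F <;> rcases Finset.mem_union.1 hx with hx | hx
    · exact ((mem_F u).1 huF).1.2 (hxu ▸ hS.parent_mem_of_mem x hx (hxu ▸ ((mem_F u).1 huF).1.1))
    · exact ((mem_F u).1 huF).1.2 (hxu ▸ ((mem_F x).1 hx).2 ▸ hv)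
    · exact hQ.parent_ne u (hold u hu huF).1 x hx hxu
    · exact (hold u hu huF).2 (hxu ▸ ((mem_F x).1 hx).2)
  · by_cases huF : u ∈ F <;> simp only [huF, if_true, if_false]
    · exact hspare u huF f hf
    · obtain ⟨hu', huv⟩ := hold u hu huF
      rcases Finset.mem_union.1 hf with hf | hf
      · obtain ⟨i, hi, hci, hfi⟩ := hQ.spare u hu' f hf
        exact ⟨.inl i, Sum.inl_injective.ne hi, by rw [hcolor, hcolor, hci], hpath i hfi⟩
      · obtain ⟨i, hi, hfi, hne'⟩ := hmem f hf (Q'.color (.inl (J u)))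
        exact ⟨i, hne' u hu' huv, hi, hfi⟩

theorem insert_child (hQ : Growing W S Q J) (hS : R.IsGrowable W S) (hv : v ∈ R.frontier W S)
    {l : V} (hl : l ∈ R.children (W \ S) v) {i : ι} (hi : v ∈ Q.path i) :
    R.IsPathSet (Q.path i ∪ {l}) := by
  obtain ⟨hlWS, rfl⟩ := mem_children.1 hl
  obtain ⟨hlW, hlS⟩ := Finset.mem_sdiff.1 hlWS
  rw [Finset.union_comm, ← Finset.insert_eq]
  refine (Q.isPathSet i).insert_child (fun h => hS.root_notMem (h ▸ hlW)) hi
    (fun y hy => hQ.parent_ne _ hv y (Q.path_subset i hy)) fun y hy hyl => hlS ?_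
  exact hyl ▸ hS.parent_mem_of_mem y (Q.path_subset i hy) (hyl ▸ hlW)

theorem isPathSet_singleton_child (hS : R.IsGrowable W S) {l : V}
    (hl : l ∈ R.children (W \ S) v) : R.IsPathSet {l} :=
  isPathSet_singleton fun h => hS.root_notMem
    (h ▸ (Finset.mem_sdiff.1 (mem_children.1 hl).1).1)

theorem isPathSet_pair_children (hS : R.IsGrowable W S) {a b : V}
    (ha : a ∈ R.children (W \ S) v) (hb : b ∈ R.children (W \ S) v) (hab : a ≠ b) :
    R.IsPathSet {a, b} := by
  have hroot : ∀ l ∈ R.children (W \ S) v, l ≠ R.root := fun l hl h =>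
    hS.root_notMem (h ▸ (Finset.mem_sdiff.1 (mem_children.1 hl).1).1)
  exact isPathSet_pair_of_parent_eq (hroot a ha) (hroot b hb) hab
    ((mem_children.1 ha).2.trans (mem_children.1 hb).2.symm)

/-- A single child `l` is appended to a path of either colour; the path `J v` is used up and passes
its role on to a new path `{l}`. -/
theorem exists_of_children_eq_singleton (hQ : Growing W S Q J) (hS : R.IsGrowable W S)
    (hv : v ∈ R.frontier W S) {l : V} (hF : R.children (W \ S) v = {l}) :
    ∃ (Q' : System R (S ∪ {l}) (ι ⊕ Unit)) (J' : V → ι ⊕ Unit), Growing W (S ∪ {l}) Q' J' := by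
  classical
  have hvS := (mem_frontier.1 hv).1
  have hl : l ∈ R.children (W \ S) v := by simp [hF]
  have hlS : l ∉ S := (Finset.mem_sdiff.1 (mem_children.1 hl).1).2
  obtain ⟨k, hk, hvk⟩ := hQ.isBichromatic v hvS (!Q.color (J v))
  have hJ := hQ.mem_path v hv
  let Q' : System R (S ∪ {l}) (ι ⊕ Unit) := Q.extend {l}
    (fun i => if i = J v ∨ i = k then {l} else ∅) (fun _ => {l}) (fun _ => Q.color k)
    (by simpa using hlS) (fun i => by split_ifs <;> simp) (fun _ => subset_rfl)
    (fun i => by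
      split_ifs with h
      · exact hQ.insert_child hS hv hl (by rcases h with rfl | rfl <;> assumption)
      · simpa using Q.isPathSet i)
    (fun _ => isPathSet_singleton_child hS hl)
    (by
      simp only [Finset.mem_singleton, forall_eq]
      intro f hf
      obtain ⟨i, hi, hci, hfi⟩ := hQ.spare v hv f hf
      have hik : i ≠ k := by rintro rfl; simp [hci] at hk
      exact ⟨(), i, by simp [hk, hci], trivial, hfi, by simp [hi, hik]⟩)
    (by simp)
  refine ⟨Q', _, hQ.union_children hS hvS hF Q' (fun _ => .inr ()) (fun _ => rfl)
    (fun i => Finset.subset_union_left) ?_ (by simp) (by simp) (by simp [Q']) ?_⟩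
  · simp only [Finset.mem_singleton, forall_eq]
    intro b
    by_cases hb : b = Q.color k
    · exact ⟨.inr (), hb.symm, by simp [Q'], by simp⟩
    · refine ⟨.inl (J v), ?_, by simp [Q'], fun u hu huv h => huv ?_⟩
      · simp [Q', Bool.eq_not_of_ne hb, hk]
      · exact hQ.injOn hu hv (Sum.inl_injective h).symm
  · simp only [Finset.mem_singleton, forall_eq, Finset.mem_union]
    rintro f (hf | rfl)
    · obtain ⟨i, hi, hfi⟩ := hQ.isBichromatic f hf (Q.color k)
      exact ⟨.inl i, by simp, hi, Finset.mem_union_left _ hfi⟩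
    · exact ⟨.inl k, by simp, rfl, Finset.mem_union_right _ (by simp)⟩

/-- The prolongation of `Q` by two children `a` and `b` of `v`: `a` is appended to the paths `J v`
and `k`, and `b` to the path `j`. The path `{a, b}` is added in both colours. -/
theorem exists_system_union_pair (hQ : Growing W S Q J) (hS : R.IsGrowable W S)
    (hv : v ∈ R.frontier W S) {a b : V} (hab : a ≠ b) (hF : R.children (W \ S) v = {a, b})
    {j k : ι} (hj : Q.color j = Q.color (J v)) (hk : Q.color k = !Q.color (J v)) (hjJ : j ≠ J v)
    (hvj : v ∈ Q.path j) (hvk : v ∈ Q.path k) :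
    ∃ Q' : System R (S ∪ {a, b}) (ι ⊕ Bool), (∀ i, Q'.color (.inl i) = Q.color i) ∧
      (∀ d, Q'.color (.inr d) = d) ∧ (∀ i, Q.path i ⊆ Q'.path (.inl i)) ∧
      (∀ d, Q'.path (.inr d) = {a, b}) ∧ a ∈ Q'.path (.inl (J v)) ∧ b ∈ Q'.path (.inl j) := by
  classical
  have ha : a ∈ R.children (W \ S) v := by simp [hF]
  have hb : b ∈ R.children (W \ S) v := by simp [hF]
  have haS : a ∉ S := (Finset.mem_sdiff.1 (mem_children.1 ha).1).2
  have hbS : b ∉ S := (Finset.mem_sdiff.1 (mem_children.1 hb).1).2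
  have hjk : j ≠ k := by rintro rfl; simp [hj] at hk
  let X : ι → Finset V := fun i => if i = J v ∨ i = k then {a} else if i = j then {b} else ∅
  have haX : ∀ i, a ∈ X i ↔ i = J v ∨ i = k := by grind
  have hbX : ∀ i, b ∈ X i ↔ i = j := by grind
  refine ⟨Q.extend {a, b} X (fun _ => {a, b}) id (by simp [haS, hbS]) (fun i => by grind)
    (fun _ => subset_rfl) (fun i => ?_) (fun _ => isPathSet_pair_children hS ha hb hab)
    (fun e he f hf => ?_) (fun e he f hf hef => ?_), fun _ => rfl, fun _ => rfl,
    fun _ => Finset.subset_union_left, fun _ => rfl,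
    Finset.mem_union_right _ ((haX _).2 (.inl rfl)), Finset.mem_union_right _ ((hbX _).2 rfl)⟩
  · simp only [X]
    split_ifs with h h'
    · exact hQ.insert_child hS hv ha (by rcases h with rfl | rfl; exacts [hQ.mem_path v hv, hvk])
    · exact hQ.insert_child hS hv hb (h' ▸ hvj)
    · simpa using Q.isPathSet i
  · rcases Finset.mem_insert.1 he with rfl | he'
    · obtain ⟨i, hi, hci, hfi⟩ := hQ.spare v hv f hf
      exact ⟨!Q.color i, i, by simp, he, hfi, by grind⟩
    · obtain rfl := Finset.mem_singleton.1 he'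
      obtain ⟨i, hci, hfi⟩ := hQ.isBichromatic f hf (!Q.color (J v))
      exact ⟨!Q.color i, i, by simp, he, hfi, by grind⟩
  · have hkj : Q.color k ≠ Q.color j := by simp [hk, hj]
    have hk' : a ∈ X k ∧ b ∉ X k := by grind
    have hj' : b ∈ X j ∧ a ∉ X j := by grind
    simp only [Finset.mem_insert, Finset.mem_singleton] at he hf
    rcases he with rfl | rfl <;> rcases hf with rfl | rfl
    · exact absurd rfl hef
    · exact ⟨.inl k, .inl j, hkj, hk', hj'⟩
    · exact ⟨.inl j, .inl k, hkj.symm, hj', hk'⟩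
    · exact absurd rfl hef

/-- The path `J v`, prolonged by `a`, serves `a`, and a new path `{a, b}` serves `b`. -/
theorem exists_of_children_eq_pair (hQ : Growing W S Q J) (hS : R.IsGrowable W S)
    (hv : v ∈ R.frontier W S) {a b : V} (hab : a ≠ b) (hF : R.children (W \ S) v = {a, b}) :
    ∃ (Q' : System R (S ∪ {a, b}) (ι ⊕ Bool)) (J' : V → ι ⊕ Bool),
      Growing W (S ∪ {a, b}) Q' J' := by
  have hvS := (mem_frontier.1 hv).1
  obtain ⟨k, hk, hvk⟩ := hQ.isBichromatic v hvS (!Q.color (J v))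
  obtain ⟨j, hjJ, hj, hvj⟩ := hQ.spare v hv v hvS
  obtain ⟨Q', hcolor, hcolor', hpath, hpath', ha, hb⟩ :=
    hQ.exists_system_union_pair hS hv hab hF hj hk hjJ hvj hvk
  refine ⟨Q', _, hQ.union_children hS hvS hF Q'
    (fun f => if f = a then .inl (J v) else .inr (Q.color (J v))) hcolor hpath
    (fun f hf d => ⟨.inr d, hcolor' d, by rwa [hpath'], by simp⟩) ?_ ?_ ?_ ?_⟩
  · grind [Set.InjOn]
  · intro f _ u hu huv
    have hJ : J v ≠ J u := fun h => huv (hQ.injOn hu hv h.symm)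
    grind
  · grind
  · intro l hl f hf
    rcases Finset.mem_insert.1 hl with rfl | hl
    · rcases Finset.mem_union.1 hf with hf | hf
      · obtain ⟨i, hi, hci, hfi⟩ := hQ.spare v hv f hf
        exact ⟨.inl i, by simpa using hi, by simp [hcolor, hci], hpath i hfi⟩
      · exact ⟨.inr (Q.color (J v)), by simp, by simp [hcolor, hcolor'], by rwa [hpath']⟩
    · obtain rfl := Finset.mem_singleton.1 hl
      have hJ' : ∃ i, Q'.color (.inl i) = Q.color (J v) ∧ f ∈ Q'.path (.inl i) := by
        simp only [Finset.mem_union, Finset.mem_insert, Finset.mem_singleton] at hf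
        rcases hf with hf | rfl | rfl
        · obtain ⟨i, hci, hfi⟩ := hQ.isBichromatic f hf (Q.color (J v))
          exact ⟨i, (hcolor i).trans hci, hpath i hfi⟩
        · exact ⟨J v, hcolor _, ha⟩
        · exact ⟨j, (hcolor j).trans hj, hb⟩
      obtain ⟨i, hci, hfi⟩ := hJ'
      exact ⟨.inl i, by simp [hab.symm], by simp [hab.symm, hci, hcolor'], hfi⟩

theorem exists_step (hQ : Growing W S Q J) (hS : R.IsGrowable W S) (hne : S ≠ W)
    (hcard : ∀ x ∈ S, (R.children (W \ S) x).card ≤ 2) :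
    ∃ F ⊆ W \ S, F.Nonempty ∧ R.IsGrowable W (S ∪ F) ∧
      ∃ (κ : Type) (_ : Fintype κ) (Q' : System R (S ∪ F) (ι ⊕ κ)) (J' : V → ι ⊕ κ),
        Fintype.card κ = F.card ∧ Growing W (S ∪ F) Q' J' := by
  obtain ⟨v, hv⟩ := hS.nonempty_frontier hne
  obtain ⟨hvS, hF⟩ := Finset.mem_filter.1 hv
  refine ⟨R.children (W \ S) v, Finset.filter_subset _ _, hF, hS.union_children hvS, ?_⟩
  have hcardF := hcard v hvS
  interval_cases h : (R.children (W \ S) v).card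
  · simp [Finset.card_eq_zero.1 h] at hF
  · obtain ⟨l, hl⟩ := Finset.card_eq_one.1 h
    obtain ⟨Q', J', hQ'⟩ := hQ.exists_of_children_eq_singleton hS hv hl
    rw [hl]
    exact ⟨Unit, inferInstance, Q', J', rfl, hQ'⟩
  · obtain ⟨a, b, hab, hl⟩ := Finset.card_eq_two.1 h
    obtain ⟨Q', J', hQ'⟩ := hQ.exists_of_children_eq_pair hS hv hab hl
    rw [hl]
    exact ⟨Bool, inferInstance, Q', J', rfl, hQ'⟩

theorem hasBichromatic [Fintype ι] (hQ : Growing W S Q J) (hS : R.IsGrowable W S)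
    (hcard : ∀ x ∈ W, (R.children (W \ S) x).card ≤ 2) :
    R.HasBichromatic W (Fintype.card ι + (W \ S).card) := by
  induction hn : (W \ S).card using Nat.strong_induction_on generalizing S ι with
  | _ n ih =>
    rcases eq_or_ne S W with rfl | hne
    · obtain rfl : 0 = n := by simpa using hn
      exact ⟨ι, _, Q, rfl, hQ.isBichromatic⟩
    obtain ⟨F, hFsub, hF, hS', κ, _, Q', J', hκ, hQ'⟩ :=
      hQ.exists_step hS hne fun x hx => hcard x (hS.subset hx)
    have hsdiff : (W \ (S ∪ F)).card + F.card = n := by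
      rw [← hn, ← Finset.card_sdiff_add_card_eq_card hFsub, ← Finset.sup_eq_union,
        sdiff_sdiff_left]
    have hcard' : ∀ x ∈ W, (R.children (W \ (S ∪ F)) x).card ≤ 2 := fun x hx =>
      (Finset.card_le_card (Finset.filter_subset_filter _
        (Finset.sdiff_subset_sdiff subset_rfl Finset.subset_union_left))).trans (hcard x hx)
    have hlt : (W \ (S ∪ F)).card < n := hsdiff ▸ Nat.lt_add_of_pos_right hF.card_pos
    have hQ'' := ih _ hlt hQ' hS' hcard' rfl
    rwa [Fintype.card_sum, hκ, add_assoc, add_comm F.card, hsdiff] at hQ''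

end Growing

/-- A design on the edges of a star whose realizations can be grown at the edges in `frontier`: the
last four conditions are those of `Growing`. -/
structure Seed (m n : ℕ) extends Design m n where
  frontier : Finset (Fin m)
  J : Fin m → Fin n
  exists_path_eq : ∀ k, ∃ e f, path k = {e, f}
  isBichromatic : ∀ e b, ∃ i, color i = b ∧ e ∈ path i
  injOn : ∀ e ∈ frontier, ∀ f ∈ frontier, J e = J f → e = f
  mem_path : ∀ e ∈ frontier, e ∈ path (J e)
  spare : ∀ e ∈ frontier, ∀ f, ∃ i ≠ J e, color i = color (J e) ∧ f ∈ path i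

namespace Seed

variable [DecidableEq V] {R : Rooting T} {W : Finset V} {m n : ℕ}

theorem hasBichromatic [NeZero n] (d : Seed m n) {y : Fin m ↪ V}
    (hy : R.IsStar (Finset.univ.map y)) (hW : R.IsGrowable W (Finset.univ.map y))
    (hcard : ∀ x ∈ W, (R.children (W \ Finset.univ.map y) x).card ≤ 2)
    (hfrontier : ∀ e ∉ d.frontier, R.children (W \ Finset.univ.map y) (y e) = ∅)
    (hparent : ∀ e ∈ d.frontier, ∀ f, R.parent (y f) ≠ y e) :
    R.HasBichromatic W (n + (W \ Finset.univ.map y).card) := by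
  have hpath : ∀ k, R.IsPathSet ((d.path k).map y) := fun k => by
    obtain ⟨e, f, hef⟩ := d.exists_path_eq k
    rw [hef, Finset.map_insert, Finset.map_singleton]
    exact hy.isPathSet_pair (Finset.mem_map_of_mem y (Finset.mem_univ e))
      (Finset.mem_map_of_mem y (Finset.mem_univ f))
  have hJ : ∀ e, Function.extend y d.J 0 (y e) = d.J e := y.injective.extend_apply _ _
  have hmem : ∀ v ∈ R.frontier W (Finset.univ.map y), ∃ e ∈ d.frontier, y e = v := by
    intro v hv
    obtain ⟨hvS, hv⟩ := Finset.mem_filter.1 hv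
    obtain ⟨e, -, rfl⟩ := Finset.mem_map.1 hvS
    exact ⟨e, not_not.1 fun he => hv.ne_empty (hfrontier e he), rfl⟩
  have hgrowing : Growing W (Finset.univ.map y) (.ofDesign d.toDesign y hpath)
      (Function.extend y d.J 0) := by
    refine ⟨fun x hx b => ?_, fun u hu v hv huv => ?_, fun v hv => ?_, fun v hv x hx => ?_,
      fun v hv x hx => ?_⟩
    · obtain ⟨e, -, rfl⟩ := Finset.mem_map.1 hx
      obtain ⟨i, hi, hei⟩ := d.isBichromatic e b
      exact ⟨i, hi, Finset.mem_map_of_mem y hei⟩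
    · obtain ⟨e, he, rfl⟩ := hmem u hu
      obtain ⟨f, hf, rfl⟩ := hmem v hv
      rw [hJ, hJ] at huv
      rw [d.injOn e he f hf huv]
    · obtain ⟨e, he, rfl⟩ := hmem v hv
      rw [hJ]
      exact Finset.mem_map_of_mem y (d.mem_path e he)
    · obtain ⟨e, he, rfl⟩ := hmem v hv
      obtain ⟨f, -, rfl⟩ := Finset.mem_map.1 hx
      exact hparent e he f
    · obtain ⟨e, he, rfl⟩ := hmem v hv
      obtain ⟨f, -, rfl⟩ := Finset.mem_map.1 hx
      obtain ⟨i, hi, hci, hfi⟩ := d.spare e he f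
      rw [hJ]
      exact ⟨i, hi, hci, Finset.mem_map_of_mem y hfi⟩
  simpa using hgrowing.hasBichromatic hW hcard

/-- Three copies of a single edge, at which they can be grown. -/
def one : Seed 1 3 where
  path := ![{0}, {0}, {0}]
  color := ![true, true, false]
  frontier := {0}
  J := ![1]
  separates := by decide
  exists_path_eq := by decide
  isBichromatic := by decide
  injOn := by decide
  mem_path := by decide
  spare := by decide

/-- Five paths on a star with three edges, at all of which they can be grown. -/
def three : Seed 3 5 where
  path := ![{0, 1}, {0, 2}, {1, 2}, {0, 1}, {1, 2}]
  color := ![true, true, true, false, false]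
  frontier := Finset.univ
  J := ![1, 0, 2]
  separates := by decide
  exists_path_eq := by decide
  isBichromatic := by decide
  injOn := by decide
  mem_path := by decide
  spare := by decide

/-- Six paths on a star with four edges, at two of which they can be grown. -/
def four : Seed 4 6 where
  path := ![{0, 1}, {1, 2}, {2, 3}, {0, 2}, {1, 3}, {2, 3}]
  color := ![true, true, true, false, false, false]
  frontier := {1, 3}
  J := ![0, 1, 0, 5]
  separates := by decide
  exists_path_eq := by decide
  isBichromatic := by decide
  injOn := by decide
  mem_path := by decide
  spare := by decide

/-- Four paths on a star with three edges. The price for saving a path compared to `three` is that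
they cannot be grown. -/
def closedThree : Seed 3 4 where
  path := ![{0, 1}, {1, 2}, {0, 2}, {1, 2}]
  color := ![true, true, false, false]
  frontier := ∅
  J := 0
  separates := by decide
  exists_path_eq := by decide
  isBichromatic := by decide
  injOn := by decide
  mem_path := by decide
  spare := by decide

end Seed

namespace Rooting

variable {R : Rooting T} {U s S : Finset V} {v : V}

variable (R) in
/-- `U` encodes the edges of a subtree of `T` that contains the root. -/
def IsSubtree (U : Finset V) : Prop :=
  R.root ∉ U ∧ ∀ x ∈ U, R.parent x ≠ R.root → R.parent x ∈ U

open Classical in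
variable (R) in
/-- The vertices of `U` that lie in `s` or are descendants of a vertex of `s`. -/
noncomputable def below (U s : Finset V) : Finset V := {y ∈ U | ∃ k, R.parent^[k] y ∈ s}

theorem mem_below {y : V} : y ∈ R.below U s ↔ y ∈ U ∧ ∃ k, R.parent^[k] y ∈ s := by
  classical exact Finset.mem_filter

theorem below_subset : R.below U s ⊆ U := fun _ hy => (mem_below.1 hy).1

theorem subset_below (hs : s ⊆ U) : s ⊆ R.below U s := fun _ hy => mem_below.2 ⟨hs hy, 0, hy⟩

theorem mem_below_of_parent_mem_below {y : V} (hy : y ∈ U) (h : R.parent y ∈ R.below U s) :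
    y ∈ R.below U s := by
  obtain ⟨-, k, hk⟩ := mem_below.1 h
  exact mem_below.2 ⟨hy, k + 1, hk⟩

theorem IsSubtree.ne_root (hU : R.IsSubtree U) {x : V} (hx : x ∈ U) : x ≠ R.root :=
  fun h => hU.1 (h ▸ hx)

theorem IsSubtree.parent_mem_below (hU : R.IsSubtree U) (hs : s ⊆ U) {y : V}
    (hy : y ∈ R.below U s) (hys : y ∉ s) : R.parent y ∈ R.below U s := by
  obtain ⟨hyU, k, hk⟩ := mem_below.1 hy
  cases k with
  | zero => exact absurd hk hys
  | succ k =>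
    refine mem_below.2 ⟨hU.2 y hyU fun h => hU.1 (hs ?_), k, hk⟩
    rwa [Function.iterate_succ_apply, h, Function.iterate_fixed R.parent_root] at hk

theorem le_depth_of_mem_below {n : ℕ} (h : ∀ x ∈ s, n ≤ R.depth x) {y : V}
    (hy : y ∈ R.below U s) : n ≤ R.depth y := by
  obtain ⟨-, k, hk⟩ := mem_below.1 hy
  clear hy
  induction k generalizing y with
  | zero => exact h y hk
  | succ k ih =>
    rcases eq_or_ne y R.root with rfl | hyr
    · exact h _ (by rwa [Function.iterate_fixed R.parent_root] at hk)
    · exact (ih hk).trans (R.depth_parent_lt y hyr).le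

theorem IsSubtree.isGrowable_below (hU : R.IsSubtree U) (hsS : s ⊆ S) (hS : S ⊆ R.below U s)
    (hparent : ∀ x ∈ S, R.parent x ∈ R.below U s → R.parent x ∈ S) :
    R.IsGrowable (R.below U s) S where
  root_notMem h := hU.1 (below_subset h)
  subset := hS
  parent_mem_of_notMem _ hx hxS :=
    hU.parent_mem_below ((hsS.trans hS).trans below_subset) hx fun h => hxS (hsS h)
  parent_mem_of_mem := hparent

theorem IsSubtree.depth_lt_of_mem_below_singleton (hU : R.IsSubtree U) (hv : v ∈ U) {x : V}
    (hx : x ∈ R.below U {v}) (hxv : x ≠ v) : R.depth v < R.depth x := by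
  have hpx := hU.parent_mem_below (by simpa using hv) hx (by simpa using hxv)
  exact (le_depth_of_mem_below (by simp) hpx).trans_lt
    (R.depth_parent_lt x (hU.ne_root (below_subset hx)))

variable [DecidableEq V]

theorem IsSubtree.sdiff_below (hU : R.IsSubtree U) : R.IsSubtree (U \ R.below U s) := by
  refine ⟨fun h => hU.1 (Finset.mem_sdiff.1 h).1, fun x hx hpx => ?_⟩
  obtain ⟨hxU, hxs⟩ := Finset.mem_sdiff.1 hx
  exact Finset.mem_sdiff.2 ⟨hU.2 x hxU hpx, fun h => hxs (mem_below_of_parent_mem_below hxU h)⟩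

theorem IsSubtree.depth_lt_of_mem_children (hU : R.IsSubtree U) {x : V}
    (hx : x ∈ R.children U v) : R.depth v < R.depth x := by
  obtain ⟨hxU, rfl⟩ := mem_children.1 hx
  exact R.depth_parent_lt x (hU.ne_root hxU)

theorem IsSubtree.depth_lt_of_mem_below (hU : R.IsSubtree U) (hs : s ⊆ R.children U v) {y : V}
    (hy : y ∈ R.below U s) : R.depth v < R.depth y :=
  le_depth_of_mem_below (fun _ hx => hU.depth_lt_of_mem_children (hs hx)) hy

theorem IsSubtree.isStar_children (hU : R.IsSubtree U) (v : V) : R.IsStar (R.children U v) :=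
  ⟨v, fun _ hx => ⟨hU.ne_root (mem_children.1 hx).1, .inr (mem_children.1 hx).2⟩⟩

theorem IsSubtree.isStar_insert_children (hU : R.IsSubtree U) (hv : v ∈ U) :
    R.IsStar (insert v (R.children U v)) := by
  refine ⟨v, fun x hx => ?_⟩
  rcases Finset.mem_insert.1 hx with rfl | hx
  · exact ⟨hU.ne_root hv, .inl rfl⟩
  · exact ⟨hU.ne_root (mem_children.1 hx).1, .inr (mem_children.1 hx).2⟩

theorem IsSubtree.isGrowable_below_singleton (hU : R.IsSubtree U) (hv : v ∈ U) :
    R.IsGrowable (R.below U {v}) (insert v (R.children U v)) := by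
  have hvb : v ∈ R.below U {v} := subset_below (by simpa using hv) (Finset.mem_singleton_self v)
  refine hU.isGrowable_below (by simp) (Finset.insert_subset hvb fun x hx => ?_) fun x hx hpx => ?_
  · refine mem_below_of_parent_mem_below (mem_children.1 hx).1 ?_
    rwa [(mem_children.1 hx).2]
  · rcases Finset.mem_insert.1 hx with rfl | hx
    · have hle : R.depth x ≤ R.depth (R.parent x) := le_depth_of_mem_below (by simp) hpx
      exact absurd (R.depth_parent_lt x (hU.ne_root hv)) hle.not_gt
    · rw [(mem_children.1 hx).2]
      exact Finset.mem_insert_self v _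

theorem IsSubtree.card_add_card_le_card_below (hU : R.IsSubtree U) (hs : s ⊆ R.children U v)
    {t : Finset V} (ht : t ⊆ s) (h : ∀ x ∈ t, (R.children U x).Nonempty) :
    s.card + t.card ≤ (R.below U s).card := by
  have : Nonempty V := ⟨v⟩
  have hsub := subset_below (R := R) (hs.trans (Finset.filter_subset _ _))
  choose! g hg using h
  have hg' : ∀ x ∈ t, g x ∈ U ∧ R.parent (g x) = x := fun x hx => mem_children.1 (hg x hx)
  have hinj : Set.InjOn g t := fun x hx y hy h => by rw [← (hg' x hx).2, h, (hg' y hy).2]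
  rw [← Finset.card_image_of_injOn hinj, ← Finset.card_union_of_disjoint]
  · refine Finset.card_le_card (Finset.union_subset hsub fun z hz => ?_)
    obtain ⟨x, hx, rfl⟩ := Finset.mem_image.1 hz
    refine mem_below_of_parent_mem_below (hg' x hx).1 ?_
    rw [(hg' x hx).2]
    exact hsub (ht hx)
  · refine Finset.disjoint_left.2 fun z hz hz' => ?_
    obtain ⟨x, hx, rfl⟩ := Finset.mem_image.1 hz'
    have hxv : x = v := (hg' x hx).2.symm.trans (mem_children.1 (hs hz)).2
    exact (hU.depth_lt_of_mem_children (hs (ht hx))).ne (by rw [hxv])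

end Rooting

namespace Seed

open Rooting

variable [DecidableEq V] {R : Rooting T}

theorem hasBichromatic_below {m n : ℕ} [NeZero n] (d : Seed m n) {U : Finset V}
    {v : V} (hU : R.IsSubtree U) (y : Fin m ↪ V) (hy : Finset.univ.map y ⊆ R.children U v)
    (hcard : ∀ x ∈ U, R.depth v < R.depth x → (R.children U x).card ≤ 2)
    (hfrontier : ∀ e ∉ d.frontier, R.children U (y e) = ∅) :
    R.HasBichromatic (R.below U (Finset.univ.map y))
      (n + ((R.below U (Finset.univ.map y)).card - m)) := by
  have hlt := fun x => hU.depth_lt_of_mem_below hy (y := x)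
  have hsub := subset_below (R := R) (hy.trans (Finset.filter_subset _ _))
  have hparent : ∀ f, R.parent (y f) = v := fun f =>
    (mem_children.1 (hy (Finset.mem_map_of_mem y (Finset.mem_univ f)))).2
  have hmono : ∀ x, R.children (R.below U (Finset.univ.map y) \ Finset.univ.map y) x ⊆
      R.children U x := fun x =>
    Finset.filter_subset_filter _ (Finset.sdiff_subset.trans below_subset)
  have hW : R.IsGrowable (R.below U (Finset.univ.map y)) (Finset.univ.map y) :=
    hU.isGrowable_below subset_rfl hsub fun x hx hpx => by
      rw [(mem_children.1 (hy hx)).2] at hpx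
      exact absurd rfl (hlt v hpx).ne
  obtain ⟨w, hw⟩ := hU.isStar_children v
  have h := d.hasBichromatic ⟨w, fun x hx => hw x (hy hx)⟩ hW
    (fun x hx => (Finset.card_le_card (hmono x)).trans (hcard x (below_subset hx) (hlt x hx)))
    (fun e he => Finset.subset_empty.1 (hfrontier e he ▸ hmono (y e))) fun e _ f hf => ?_
  · rwa [Finset.card_sdiff_of_subset hsub, Finset.card_map, Finset.card_univ, Fintype.card_fin] at h
  · exact (hlt _ (hsub (Finset.mem_map_of_mem y (Finset.mem_univ e)))).ne (by rw [← hf, hparent])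

theorem hasBichromatic_below_singleton {m n : ℕ} [NeZero n] (d : Seed m n) {U : Finset V} {v : V}
    (hU : R.IsSubtree U) (hv : v ∈ U) (y : Fin m ↪ V)
    (hy : Finset.univ.map y = insert v (R.children U v))
    (hcard : ∀ x ∈ U, R.depth v < R.depth x → (R.children U x).card ≤ 2)
    (hfrontier : ∀ e ∉ d.frontier, y e = v ∨ R.children U (y e) = ∅)
    (hne : ∀ e ∈ d.frontier, y e ≠ v) :
    R.HasBichromatic (R.below U {v}) (n + ((R.below U {v}).card - m)) := by
  have hW := hU.isGrowable_below_singleton hv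
  have hmono : ∀ z, R.children (R.below U {v} \ insert v (R.children U v)) z ⊆ R.children U z :=
    fun z => Finset.filter_subset_filter _ (Finset.sdiff_subset.trans below_subset)
  have hchildren : R.children (R.below U {v} \ insert v (R.children U v)) v = ∅ :=
    Finset.eq_empty_of_forall_notMem fun z hz =>
      (Finset.mem_sdiff.1 (mem_children.1 hz).1).2 (Finset.mem_insert_of_mem (hmono v hz))
  have hmem : ∀ e, y e = v ∨ y e ∈ R.children U v := fun e =>
    Finset.mem_insert.1 (hy ▸ Finset.mem_map_of_mem y (Finset.mem_univ e))
  have h := d.hasBichromatic (hy ▸ hU.isStar_insert_children hv) (hy ▸ hW)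
    (fun z hz => ?_) (fun e he => ?_) fun e he f hf => ?_
  · rwa [Finset.card_sdiff_of_subset (hy ▸ hW.subset), Finset.card_map, Finset.card_univ,
      Fintype.card_fin] at h
  · rw [hy]
    rcases eq_or_ne z v with rfl | hzv
    · simp [hchildren]
    · exact (Finset.card_le_card (hmono z)).trans
        (hcard z (below_subset hz) (hU.depth_lt_of_mem_below_singleton hv hz hzv))
  · rw [hy]
    rcases hfrontier e he with h | h
    · rw [h, hchildren]
    · exact Finset.subset_empty.1 (h ▸ hmono (y e))
  · have hve := hU.depth_lt_of_mem_children ((hmem e).resolve_left (hne e he))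
    rcases hmem f with h | h
    · rw [h] at hf
      exact ((R.depth_parent_lt v (hU.ne_root hv)).trans hve).ne (by rw [hf])
    · exact hne e he (hf ▸ (mem_children.1 h).2)

end Seed

theorem exists_embedding_map_eq {s : Finset V} {m : ℕ} (hs : s.card = m) :
    ∃ y : Fin m ↪ V, Finset.univ.map y = s := by
  refine ⟨(s.equivFinOfCardEq hs).symm.toEmbedding.trans (Function.Embedding.subtype _), ?_⟩
  rw [← Finset.map_map, Finset.map_univ_equiv]
  ext x
  simp

namespace Rooting

variable {R : Rooting T} [DecidableEq V] {U s : Finset V} {v : V} {n : ℕ}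

variable (R) in
/-- The edges of `E` have a covering separating system of at most `4 |E| / 3` paths. -/
def HasSmallCovering (E : Finset V) : Prop := ∃ n, 3 * n ≤ 4 * E.card ∧ R.HasCovering E n

variable (R) in
/-- A pendant part of `U` can be removed in the inductive construction of small coverings. -/
def IsReducible (U : Finset V) : Prop :=
  ∃ s ⊆ U, s.Nonempty ∧ (R.HasSmallCovering (U \ R.below U s) → R.HasSmallCovering U)

theorem HasBichromatic.isReducible (h : R.HasBichromatic (R.below U s) n) (hsU : s ⊆ U)
    (hs : s.Nonempty) (hn : 3 * n ≤ 4 * (R.below U s).card) : R.IsReducible U := by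
  refine ⟨s, hsU, hs, fun ⟨m, hm, hc⟩ => ⟨m + n, ?_, ?_⟩⟩
  · rw [← Finset.card_sdiff_add_card_eq_card (below_subset (R := R) (s := s))]
    omega
  · simpa only [Finset.sdiff_union_of_subset below_subset] using
      hc.union h Finset.sdiff_disjoint

theorem IsSubtree.isReducible_of_three (hU : R.IsSubtree U) {d : Seed 3 n} [NeZero n]
    (hs : s ⊆ R.children U v) (hs3 : s.card = 3)
    (hcard : ∀ x ∈ U, R.depth v < R.depth x → (R.children U x).card ≤ 2)
    (hfrontier : ∀ x ∈ s, ∀ e ∉ d.frontier, R.children U x = ∅)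
    (hn : 3 * n ≤ (R.below U s).card + 9) : R.IsReducible U := by
  obtain ⟨y, rfl⟩ := exists_embedding_map_eq hs3
  have hsU := hs.trans (Finset.filter_subset _ _)
  have h3 := Finset.card_le_card (subset_below (R := R) hsU)
  refine (d.hasBichromatic_below hU y hs hcard fun e he =>
    hfrontier _ (Finset.mem_map_of_mem y (Finset.mem_univ e)) e he).isReducible hsU ?_ ?_
  · exact Finset.card_pos.1 (by omega)
  · omega

theorem IsSubtree.isReducible_of_three_leaves (hU : R.IsSubtree U)
    (hcard : ∀ x ∈ U, R.depth v < R.depth x → (R.children U x).card ≤ 2)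
    (h : 3 ≤ ((R.children U v).filter fun x => R.children U x = ∅).card) : R.IsReducible U := by
  obtain ⟨s, hs, hs3⟩ := Finset.exists_subset_card_eq h
  have hsC := hs.trans (Finset.filter_subset _ _)
  have hsU := hsC.trans (Finset.filter_subset _ _)
  refine hU.isReducible_of_three (d := .closedThree) hsC hs3 hcard
    (fun x hx _ _ => (Finset.mem_filter.1 (hs hx)).2) ?_
  have := Finset.card_le_card (subset_below (R := R) hsU)
  omega

theorem IsSubtree.isReducible_of_three_nonleaves (hU : R.IsSubtree U)
    (hcard : ∀ x ∈ U, R.depth v < R.depth x → (R.children U x).card ≤ 2)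
    (h : 3 ≤ ((R.children U v).filter fun x => (R.children U x).Nonempty).card) :
    R.IsReducible U := by
  obtain ⟨s, hs, hs3⟩ := Finset.exists_subset_card_eq h
  have hsC := hs.trans (Finset.filter_subset _ _)
  refine hU.isReducible_of_three (d := .three) hsC hs3 hcard
    (fun _ _ e he => absurd (Finset.mem_univ e) he) ?_
  have := hU.card_add_card_le_card_below hsC subset_rfl
    fun x hx => (Finset.mem_filter.1 (hs hx)).2
  omega

theorem IsSubtree.isReducible_of_four (hU : R.IsSubtree U)
    (hcard : ∀ x ∈ U, R.depth v < R.depth x → (R.children U x).card ≤ 2)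
    {x a b c : V} (hnodup : [x, a, b, c].Nodup) (hs : {x, a, b, c} ⊆ R.children U v)
    (hx : R.children U x = ∅) (hb : R.children U b = ∅)
    (hn : 6 ≤ (R.below U {x, a, b, c}).card) : R.IsReducible U := by
  let y : Fin 4 ↪ V := ⟨![x, a, b, c], List.nodup_ofFn.1 (by simpa using hnodup)⟩
  have hy : Finset.univ.map y = {x, a, b, c} := by
    ext z
    simp [y, Fin.exists_fin_succ, eq_comm]
  have h := Seed.four.hasBichromatic_below hU y (hy ▸ hs) hcard
    (by simp [Fin.forall_fin_succ, Seed.four, y, hx, hb])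
  rw [hy] at h
  refine h.isReducible (hs.trans (Finset.filter_subset _ _)) (Finset.insert_nonempty _ _) ?_
  omega

theorem IsSubtree.isReducible_of_children_eq (hU : R.IsSubtree U) (hv : v ∈ U)
    (hcard : ∀ x ∈ U, R.depth v < R.depth x → (R.children U x).card ≤ 2)
    {x a c : V} (hnodup : [x, a, c].Nodup) (hC : R.children U v = {x, a, c})
    (hx : R.children U x = ∅) (hn : 6 ≤ (R.below U {v}).card) : R.IsReducible U := by
  have hne : ∀ z ∈ [x, a, c], v ≠ z := fun z hz h =>
    (hU.depth_lt_of_mem_children (hC ▸ by simpa using hz : z ∈ R.children U v)).ne (by rw [h])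
  have hnodup' : [x, a, v, c].Nodup := by grind
  let y : Fin 4 ↪ V := ⟨![x, a, v, c], List.nodup_ofFn.1 (by simpa using hnodup')⟩
  have hy : Finset.univ.map y = insert v (R.children U v) := by
    rw [hC, Finset.insert_comm v x, Finset.insert_comm v a]
    ext z
    simp [y, Fin.exists_fin_succ, eq_comm]
  have h := Seed.four.hasBichromatic_below_singleton hU hv y hy hcard
    (by simp [Fin.forall_fin_succ, Seed.four, y, hx])
    (by simp [Seed.four, y, (hne a (by simp)).symm, (hne c (by simp)).symm])
  refine h.isReducible (Finset.singleton_subset_iff.2 hv) (Finset.singleton_nonempty v) ?_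
  omega

end Rooting

namespace Design

variable {m n : ℕ}

/-- The design with colours kept if `p` holds and exchanged otherwise. -/
def recolor (d : Design m n) (p : Bool) : Design m n where
  path := d.path
  color k := d.color k == p
  separates e f hef := by
    obtain ⟨i, j, hc, h⟩ := d.separates e f hef
    exact ⟨i, j, by cases p <;> simpa using hc, h⟩

/-- With edges `x, c, a, d`, where `d` is attached to `a`: the path `{0}` is to be appended to an
old path through the common parent of `x`, `c` and `a`. -/
def fork : Design 4 6 where
  path := ![{0}, {0, 2, 3}, {1, 2}, {0, 1}, {1, 2}, {3}]
  color := ![true, true, true, false, false, false]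
  separates := by decide

/-- With edges `v, x, c, a, d`, where `x`, `c` and `a` are attached to `v`, and `d` to `a`. -/
def spider : Design 5 6 where
  path := ![{0, 3, 4}, {1, 3}, {0, 2}, {1, 2}, {0, 1}, {4}]
  color := ![true, true, true, false, false, false]
  separates := by decide

end Design

namespace System

variable {R : Rooting T} {H : Finset V} {ι : Type} {S : System R H ι} {P : ι} {v : V}

theorem path_eq_singleton_of_unique (hP : v ∈ S.path P) (h : ∀ i, v ∈ S.path i → i = P) :
    S.path P = {v} := by
  refine Finset.eq_singleton_iff_unique_mem.2 ⟨hP, fun f hf => not_not.1 fun hfv => ?_⟩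
  obtain ⟨i, -, -, ⟨hvi, hfi⟩, -⟩ := S.separates v (S.path_subset P hP) f (S.path_subset P hf)
    (Ne.symm hfv)
  exact hfi (h i hvi ▸ hf)

variable [DecidableEq V]

/-- The first path of the design is appended to `P`, which requires `P` to be dispensable in
separating the old edges from the new ones. -/
theorem IsCovering.exists_union_map (hS : S.IsCovering) (hspare : ∀ f ∈ H, ∃ i ≠ P, f ∈ S.path i)
    {m n : ℕ} (d : Design m (n + 1)) (hd : d.color 0 = S.color P)
    (hbichromatic : ∀ e b, ∃ k : Fin n, d.color k.succ = b ∧ e ∈ d.path k.succ) (y : Fin m ↪ V)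
    (hdisj : Disjoint H (Finset.univ.map y))
    (hpath₀ : R.IsPathSet (S.path P ∪ (d.path 0).map y))
    (hpath : ∀ k : Fin n, R.IsPathSet ((d.path k.succ).map y)) :
    ∃ S' : System R (H ∪ Finset.univ.map y) (ι ⊕ Fin n), S'.IsCovering := by
  classical
  have hsub : ∀ k, (d.path k).map y ⊆ Finset.univ.map y := fun k =>
    Finset.map_subset_map.2 (Finset.subset_univ _)
  let X : ι → Finset V := fun i => if i = P then (d.path 0).map y else ∅
  let N : Fin n → Finset V := fun k => (d.path k.succ).map y
  let index : Fin (n + 1) → ι ⊕ Fin n := Fin.cons (.inl P) .inr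
  have hcolor : ∀ k, Sum.elim S.color (fun k => d.color k.succ) (index k) = d.color k :=
    Fin.cases hd.symm fun _ => rfl
  have hmem : ∀ e k, y e ∈ Sum.elim X N (index k) ↔ e ∈ d.path k := by
    refine fun e => Fin.cases ?_ fun k => ?_ <;> simp [index, X, N]
  refine ⟨S.extend (Finset.univ.map y) X N (fun k => d.color k.succ) hdisj
    (fun i => ?_) (fun k => hsub _) (fun i => ?_) hpath (fun e he f hf => ?_)
    (fun e he f hf hef => ?_), fun e he => ?_⟩
  · dsimp only [X]
    split_ifs
    exacts [hsub 0, Finset.empty_subset _]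
  · dsimp only [X]
    split_ifs with hi
    · exact hi ▸ hpath₀
    · simpa using S.isPathSet i
  · obtain ⟨e, -, rfl⟩ := Finset.mem_map.1 he
    obtain ⟨i, hi, hfi⟩ := hspare f hf
    obtain ⟨k, hk, hek⟩ := hbichromatic e (!S.color i)
    exact ⟨k, i, by simp [hk], Finset.mem_map_of_mem y hek, hfi, by simp [X, hi]⟩
  · obtain ⟨e, -, rfl⟩ := Finset.mem_map.1 he
    obtain ⟨f, -, rfl⟩ := Finset.mem_map.1 hf
    obtain ⟨i, j, hc, hi, hj⟩ := d.separates e f fun h => hef (h ▸ rfl)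
    exact ⟨index i, index j, by rwa [hcolor, hcolor], by simpa only [hmem] using hi,
      by simpa only [hmem] using hj⟩
  · rcases Finset.mem_union.1 he with he | he
    · obtain ⟨b, i, hi, hei⟩ := hS e he
      exact ⟨b, .inl i, hi, Finset.mem_union_left _ hei⟩
    · obtain ⟨e, -, rfl⟩ := Finset.mem_map.1 he
      obtain ⟨k, hk, hek⟩ := hbichromatic e true
      exact ⟨true, .inr k, hk, Finset.mem_map_of_mem y hek⟩

/-- If `v` lies on the path `P` only, then separating `v` from the other edges forces these onto
paths of the other colour; moreover `P = {v}` can be dropped together with `v`. -/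
theorem exists_erase (hP : v ∈ S.path P) (h : ∀ i, v ∈ S.path i → i = P) :
    ∃ S' : System R (H.erase v) {i // i ≠ P}, ∀ f ∈ H.erase v, S'.Has (!S.color P) f := by
  have hPv := path_eq_singleton_of_unique hP h
  have hne : ∀ f ∈ H.erase v, ∀ i, f ∈ S.path i → i ≠ P := by
    rintro f hf i hfi rfl
    exact Finset.ne_of_mem_erase hf (by simpa [hPv] using hfi)
  refine ⟨⟨fun i => S.path i, fun i => S.color i, fun i => S.isPathSet i, fun i => ?_,
    fun e he f hf hef => ?_⟩, fun f hf => ?_⟩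
  · exact Finset.subset_erase.2 ⟨S.path_subset i, fun hv => i.2 (h i hv)⟩
  · obtain ⟨i, j, hc, hi, hj⟩ := S.separates e (Finset.mem_of_mem_erase he) f
      (Finset.mem_of_mem_erase hf) hef
    exact ⟨⟨i, hne e he i hi.1⟩, ⟨j, hne f hf j hj.1⟩, hc, hi, hj⟩
  · obtain ⟨i, j, hc, hi, hj⟩ := S.separates v (S.path_subset P hP) f (Finset.mem_of_mem_erase hf)
      (Finset.ne_of_mem_erase hf).symm
    refine ⟨⟨j, hne f hf j hj.1⟩, ?_, hj.1⟩
    rw [h i hi.1] at hc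
    exact Bool.eq_not_of_ne hc.symm

end System

namespace Rooting

variable {R : Rooting T} [DecidableEq V] {H : Finset V} {n : ℕ} {v x c a d : V}

theorem isPathSet_of_parent_of_parent {z : V} (hz : z ≠ R.root) (hzv : z = v ∨ R.parent z = v)
    (ha : a ≠ R.root) (hav : R.parent a = v) (hd : d ≠ R.root) (hda : R.parent d = a) :
    R.IsPathSet {z, a, d} := by
  have hza := R.depth_parent_lt z hz
  have hva := R.depth_parent_lt a ha
  have had := R.depth_parent_lt d hd
  rw [hav] at hva
  rw [hda] at had
  have hpz : R.depth (R.parent z) < R.depth a := by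
    rcases hzv with rfl | h
    · exact hza.trans hva
    · rwa [h]
  have hstar : R.IsStar {z, a} := ⟨v, by simp [hz, hzv, ha, hav]⟩
  rw [Finset.pair_comm, Finset.insert_comm]
  refine (hstar.isPathSet_pair (by simp) (by simp)).insert_child hd (by simp [hda]) ?_ ?_
  · simp only [Finset.mem_insert, Finset.mem_singleton, forall_eq_or_imp, forall_eq, hda, hav]
    exact ⟨fun h => hpz.ne (by rw [h]), fun h => hva.ne (by rw [h])⟩
  · simp only [Finset.mem_insert, Finset.mem_singleton, forall_eq_or_imp, forall_eq, hav]
    exact ⟨fun h => (hpz.trans had).ne (by rw [h]), fun h => (hva.trans had).ne (by rw [h])⟩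

/-- Three children `x`, `c`, `a` of `v`, the last one with a child `d`, are attached to `H`. -/
structure IsFork (R : Rooting T) (H : Finset V) (v x c a d : V) : Prop where
  mem : v ∈ H
  root_notMem : R.root ∉ H
  ne_root : ∀ z ∈ [x, c, a, d], z ≠ R.root
  notMem : ∀ z ∈ [x, c, a, d], z ∉ H
  nodup : [x, c, a, d].Nodup
  parent_x : R.parent x = v
  parent_c : R.parent c = v
  parent_a : R.parent a = v
  parent_d : R.parent d = a
  parent_ne : ∀ y ∈ H, R.parent y ≠ v ∧ R.parent y ≠ x

namespace IsFork

theorem isStar (h : R.IsFork H v x c a d) : R.IsStar {v, x, c, a} := by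
  have := h.ne_root
  have hv : v ≠ R.root := fun hv => h.root_notMem (hv ▸ h.mem)
  simp only [List.forall_mem_cons] at this
  exact ⟨v, by simp [h.parent_x, h.parent_c, h.parent_a, hv, this]⟩

theorem isPathSet_pair (h : R.IsFork H v x c a d) {z w : V} (hz : z ∈ ({v, x, c, a} : Finset V))
    (hw : w ∈ ({v, x, c, a} : Finset V)) : R.IsPathSet {z, w} :=
  h.isStar.isPathSet_pair hz hw

theorem isPathSet_triple {z : V} (h : R.IsFork H v x c a d) (hz : z ∈ ({v, x, c, a} : Finset V)) :
    R.IsPathSet {z, a, d} := by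
  obtain ⟨w, hw⟩ := h.isStar
  have hv : v ≠ R.root := fun hv => h.root_notMem (hv ▸ h.mem)
  refine isPathSet_of_parent_of_parent (hw z hz).1 ?_ (h.ne_root a (by simp))
    h.parent_a (h.ne_root d (by simp)) h.parent_d
  simp only [Finset.mem_insert, Finset.mem_singleton] at hz
  rcases hz with rfl | rfl | rfl | rfl
  exacts [.inl rfl, .inr h.parent_x, .inr h.parent_c, .inr h.parent_a]

theorem hasCovering_of_spare {ι : Type} [Fintype ι] {S : System R H ι}
    (h : R.IsFork H v x c a d) (hS : S.IsCovering) {P : ι} (hP : v ∈ S.path P)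
    (hspare : ∃ i ≠ P, v ∈ S.path i) :
    R.HasCovering (H ∪ {x, c, a, d}) (Fintype.card ι + 5) := by
  have hspare' : ∀ f ∈ H, ∃ i ≠ P, f ∈ S.path i := by
    intro f hf
    rcases eq_or_ne f v with rfl | hfv
    · exact hspare
    · obtain ⟨i, -, -, ⟨hi, hvi⟩, -⟩ := S.separates f hf v h.mem hfv
      exact ⟨i, fun hiP => hvi (hiP ▸ hP), hi⟩
  let y : Fin 4 ↪ V := ⟨![x, c, a, d], List.nodup_ofFn.1 (by simpa using h.nodup)⟩
  have hy : Finset.univ.map y = {x, c, a, d} := by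
    ext z
    simp [y, Fin.exists_fin_succ, eq_comm]
  have hpath₀ : R.IsPathSet (S.path P ∪ {x}) := by
    rw [Finset.union_comm, ← Finset.insert_eq]
    refine (S.isPathSet P).insert_child (h.ne_root x (by simp)) (h.parent_x ▸ hP) ?_ ?_ <;>
      intro z hz
    exacts [h.parent_x ▸ (h.parent_ne z (S.path_subset P hz)).1,
      (h.parent_ne z (S.path_subset P hz)).2]
  have hpath : ∀ k : Fin 5, R.IsPathSet ((Design.fork.path k.succ).map y) := by
    simp [Fin.forall_fin_succ, Design.fork, y, h.isPathSet_pair, h.isPathSet_triple,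
      Rooting.isPathSet_singleton (h.ne_root d (by simp))]
  rw [← hy]
  obtain ⟨S', hS'⟩ := hS.exists_union_map hspare' (Design.fork.recolor (S.color P))
    (by cases S.color P <;> rfl) (by cases S.color P <;> decide) y
    (hy ▸ Finset.disjoint_right.2 (by simpa using h.notMem))
    (by simpa [Design.fork, Design.recolor, y] using hpath₀) hpath
  exact ⟨_, inferInstance, S', by simp, hS'⟩

theorem hasCovering_of_unique {ι : Type} [Fintype ι] {S : System R H ι}
    (h : R.IsFork H v x c a d) {P : ι} (hP : v ∈ S.path P)
    (hunique : ∀ i, v ∈ S.path i → i = P) :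
    R.HasCovering (H ∪ {x, c, a, d}) (Fintype.card ι + 5) := by
  obtain ⟨S₁, h₁⟩ := S.exists_erase hP hunique
  have hnodup : [v, x, c, a, d].Nodup :=
    h.nodup.cons fun hv => h.notMem v hv h.mem
  let y : Fin 5 ↪ V := ⟨![v, x, c, a, d], List.nodup_ofFn.1 (by simpa using hnodup)⟩
  have hy : Finset.univ.map y = {v, x, c, a, d} := by
    ext z
    simp [y, Fin.exists_fin_succ, eq_comm]
  have hpath : ∀ k, R.IsPathSet ((Design.spider.path k).map y) := by
    simp [Fin.forall_fin_succ, Design.spider, y, h.isPathSet_pair, h.isPathSet_triple,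
      Rooting.isPathSet_singleton (h.ne_root d (by simp))]
  let S₂ : System R (Finset.univ.map y) (Fin 6) :=
    .ofDesign (Design.spider.recolor (S.color P)) y hpath
  have h₂ : ∀ e ∈ Finset.univ.map y, S₂.Has (S.color P) e := by
    have hspider : ∀ p e, ∃ k, (Design.spider.recolor p).color k = p ∧
        e ∈ Design.spider.path k := by
      decide
    simp only [Finset.mem_map, Finset.mem_univ, true_and, forall_exists_index,
      forall_apply_eq_imp_iff]
    exact fun e => (hspider (S.color P) e).imp fun k hk => ⟨hk.1, Finset.mem_map_of_mem y hk.2⟩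
  have hdisj : Disjoint (H.erase v) (Finset.univ.map y) := by
    rw [hy, Finset.disjoint_insert_right]
    refine ⟨Finset.notMem_erase v H, Finset.disjoint_right.2 fun z hz hz' => ?_⟩
    exact h.notMem z (by simpa using hz) (Finset.mem_of_mem_erase hz')
  have hunion : H.erase v ∪ Finset.univ.map y = H ∪ {x, c, a, d} := by
    rw [hy, Finset.union_insert, ← Finset.insert_union, Finset.insert_erase h.mem]
  have hcolor : ∀ e ∈ H.erase v, ∀ f ∈ Finset.univ.map y, ∃ b, S₁.Has b e ∧ S₂.Has (!b) f :=
    fun e he f hf => ⟨_, h₁ e he, by simpa using h₂ f hf⟩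
  rw [← hunion]
  classical
  refine ⟨_, inferInstance, S₁.union S₂ hdisj hcolor, ?_,
    System.IsCovering.union (fun e he => ⟨_, h₁ e he⟩) (fun e he => ⟨_, h₂ e he⟩) hdisj hcolor⟩
  have := Fintype.card_pos_iff.2 ⟨P⟩
  rw [Fintype.card_sum, Fintype.card_subtype_compl, Fintype.card_subtype_eq, Fintype.card_fin]
  omega

theorem hasCovering (h : R.IsFork H v x c a d) (hH : R.HasCovering H n) :
    R.HasCovering (H ∪ {x, c, a, d}) (n + 5) := by
  obtain ⟨ι, _, S, rfl, hS⟩ := hH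
  obtain ⟨b, P, -, hP⟩ := hS v h.mem
  by_cases hspare : ∃ i ≠ P, v ∈ S.path i
  · exact h.hasCovering_of_spare hS hP hspare
  · exact h.hasCovering_of_unique hP fun i hi => not_not.1 fun hiP => hspare ⟨i, hiP, hi⟩

end IsFork

variable {U : Finset V}

theorem IsSubtree.isFork_sdiff_below (hU : R.IsSubtree U) (hv : v ∈ U)
    (hnodup : [x, c, a].Nodup) (hC : R.children U v = {x, c, a}) (hd : d ∈ R.children U a) :
    {x, c, a, d} ⊆ R.below U (R.children U v) ∧
      R.IsFork (U \ R.below U (R.children U v)) v x c a d := by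
  obtain ⟨hdU, hda⟩ := mem_children.1 hd
  have hvD : v ∉ R.below U (R.children U v) := fun h =>
    (hU.depth_lt_of_mem_below subset_rfl h).ne rfl
  have hCD : R.children U v ⊆ R.below U (R.children U v) := subset_below (Finset.filter_subset _ _)
  have hchild : ∀ z ∈ [x, c, a], z ∈ R.children U v := by simp [hC]
  have hmem : ∀ z ∈ [x, c, a, d], z ∈ R.below U (R.children U v) := by
    have hdD := mem_below_of_parent_mem_below hdU (hda.symm ▸ hCD (hchild a (by simp)))
    intro z hz
    rcases List.mem_append.1 (show z ∈ [x, c, a] ++ [d] from hz) with hz | hz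
    · exact hCD (hchild z hz)
    · rwa [List.mem_singleton.1 hz]
  have hparent : ∀ z ∈ [x, c, a], R.parent z = v := fun z hz => (mem_children.1 (hchild z hz)).2
  have hd' : d ∉ [x, c, a] := fun h =>
    (hU.depth_lt_of_mem_children (hchild a (by simp))).ne (by rw [← hda, hparent d h])
  refine ⟨fun z hz => hmem z (by simpa using hz), ?_⟩
  refine ⟨Finset.mem_sdiff.2 ⟨hv, hvD⟩, fun h => hU.1 (Finset.mem_sdiff.1 h).1,
    fun z hz => hU.ne_root (below_subset (hmem z hz)),
    fun z hz h => (Finset.mem_sdiff.1 h).2 (hmem z hz),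
    List.nodup_append.2 ⟨hnodup, List.nodup_singleton d, ?_⟩, hparent x (by simp),
    hparent c (by simp), hparent a (by simp), hda, fun y hy => ?_⟩
  · exact fun z hz w hw h => hd' (List.mem_singleton.1 hw ▸ h ▸ hz)
  · obtain ⟨hyU, hyD⟩ := Finset.mem_sdiff.1 hy
    exact ⟨fun h => hyD (hCD (mem_children.2 ⟨hyU, h⟩)), fun h =>
      hyD (mem_below_of_parent_mem_below hyU (h ▸ hmem x (by simp)))⟩

theorem IsSubtree.isReducible_of_card_below_le (hU : R.IsSubtree U) (hv : v ∈ U)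
    (hnodup : [x, c, a].Nodup) (hC : R.children U v = {x, c, a}) (hd : d ∈ R.children U a)
    (hcard : (R.below U (R.children U v)).card ≤ 4) : R.IsReducible U := by
  obtain ⟨hsub, hfork⟩ := hU.isFork_sdiff_below hv hnodup hC hd
  have hcard' : ({x, c, a, d} : Finset V).card = 4 := by
    simpa using List.toFinset_card_of_nodup hfork.nodup
  have hD := Finset.eq_of_subset_of_card_le hsub (hcard.trans hcard'.ge)
  refine ⟨R.children U v, Finset.filter_subset _ _, hC ▸ Finset.insert_nonempty _ _,
    fun ⟨m, hm, hc⟩ => ⟨m + 5, ?_, ?_⟩⟩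
  · have := Finset.card_sdiff_add_card_eq_card
      (below_subset (R := R) (U := U) (s := R.children U v))
    rw [← hD, hcard'] at this
    rw [← hD] at hm
    omega
  · simpa only [hD, Finset.sdiff_union_of_subset below_subset] using hfork.hasCovering hc

theorem IsSubtree.isReducible_of_card_children_eq_three (hU : R.IsSubtree U) (hv : v ∈ U)
    (hcard : ∀ x ∈ U, R.depth v < R.depth x → (R.children U x).card ≤ 2)
    (hC : (R.children U v).card = 3) (hx : x ∈ R.children U v)
    (hxU : R.children U x = ∅) (ha : a ∈ R.children U v)
    (haU : (R.children U a).Nonempty) : R.IsReducible U := by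
  have hxa : x ≠ a := fun h => haU.ne_empty (h ▸ hxU)
  obtain ⟨c, hc, hcx, hca⟩ : ∃ c ∈ R.children U v, c ≠ x ∧ c ≠ a := by
    by_contra! h
    have hsub : R.children U v ⊆ {x, a} := fun c hc => by
      simpa only [Finset.mem_insert, Finset.mem_singleton] using or_iff_not_imp_left.2 (h c hc)
    have := Finset.card_le_card hsub
    rw [Finset.card_pair hxa] at this
    omega
  have hnodup : [x, c, a].Nodup := by simp [hxa, hcx.symm, hca]
  have hC' : R.children U v = {x, c, a} := by
    refine (Finset.eq_of_subset_of_card_le ?_ ?_).symm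
    · simp [Finset.insert_subset_iff, hx, hc, ha]
    · rw [hC, Finset.card_eq_three.2 ⟨x, c, a, hcx.symm, hxa, hca, rfl⟩]
  rcases le_or_gt (R.below U (R.children U v)).card 4 with h | h
  · obtain ⟨d, hd⟩ := haU
    exact hU.isReducible_of_card_below_le hv hnodup hC' hd h
  · refine hU.isReducible_of_children_eq hv hcard hnodup hC' hxU ?_
    have hvD : v ∉ R.below U (R.children U v) := fun h =>
      (hU.depth_lt_of_mem_below subset_rfl h).ne rfl
    have hvb : v ∈ R.below U {v} := subset_below (by simpa using hv) (Finset.mem_singleton_self v)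
    have hsub : insert v (R.below U (R.children U v)) ⊆ R.below U {v} := by
      refine Finset.insert_subset hvb fun y hy => ?_
      obtain ⟨hyU, k, hk⟩ := mem_below.1 hy
      refine mem_below.2 ⟨hyU, k + 1, ?_⟩
      rw [Function.iterate_succ_apply', (mem_children.1 hk).2]
      exact Finset.mem_singleton_self v
    have := Finset.card_le_card hsub
    rw [Finset.card_insert_of_notMem hvD] at this
    omega

theorem IsSubtree.isReducible_of_four_le_card_children (hU : R.IsSubtree U)
    (hcard : ∀ x ∈ U, R.depth v < R.depth x → (R.children U x).card ≤ 2)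
    (hleaf : 2 ≤ ((R.children U v).filter fun x => R.children U x = ∅).card)
    (hnonleaf : 2 ≤ ((R.children U v).filter fun x => (R.children U x).Nonempty).card) :
    R.IsReducible U := by
  obtain ⟨x, hx, b, hb, hxb⟩ := Finset.one_lt_card.1 hleaf
  obtain ⟨a, ha, c, hc, hac⟩ := Finset.one_lt_card.1 hnonleaf
  simp only [Finset.mem_filter] at hx hb ha hc
  have hne : ∀ {z w}, R.children U z = ∅ → (R.children U w).Nonempty → z ≠ w :=
    fun hz hw h => hw.ne_empty (h ▸ hz)
  have hnodup : [x, a, b, c].Nodup := by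
    simp [hxb, hac, hne hx.2 ha.2, hne hx.2 hc.2, hne hb.2 hc.2, (hne hb.2 ha.2).symm]
  have hs : {x, a, b, c} ⊆ R.children U v := by
    simp only [Finset.insert_subset_iff, Finset.singleton_subset_iff, hx.1, ha.1, hb.1, hc.1,
      and_self]
  refine hU.isReducible_of_four hcard hnodup hs hx.2 hb.2 ?_
  have h4 : ({x, a, b, c} : Finset V).card = 4 := by
    simpa using List.toFinset_card_of_nodup hnodup
  have := hU.card_add_card_le_card_below hs (t := {a, c}) (by grind) (by simp [ha.2, hc.2])
  rw [h4, Finset.card_pair hac] at this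
  exact this

theorem IsSubtree.isReducible (hU : R.IsSubtree U) (h : ∃ v ∈ U, 3 ≤ (R.children U v).card) :
    R.IsReducible U := by
  obtain ⟨v, hv, hmax⟩ := (U.filter fun v => 3 ≤ (R.children U v).card).exists_max_image R.depth
    (by simpa only [Finset.filter_nonempty_iff] using h)
  obtain ⟨hv, hv3⟩ := Finset.mem_filter.1 hv
  have hcard : ∀ x ∈ U, R.depth v < R.depth x → (R.children U x).card ≤ 2 := fun x hx hlt => by
    by_contra! hx3
    exact (hmax x (Finset.mem_filter.2 ⟨hx, hx3⟩)).not_gt hlt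
  have hsum := (R.children U v).card_filter_add_card_filter_not fun x => R.children U x = ∅
  simp only [← Finset.nonempty_iff_ne_empty] at hsum
  by_cases hleaf : 3 ≤ ((R.children U v).filter fun x => R.children U x = ∅).card
  · exact hU.isReducible_of_three_leaves hcard hleaf
  by_cases hnonleaf : 3 ≤ ((R.children U v).filter fun x => (R.children U x).Nonempty).card
  · exact hU.isReducible_of_three_nonleaves hcard hnonleaf
  by_cases hv4 : 4 ≤ (R.children U v).card
  · exact hU.isReducible_of_four_le_card_children hcard (by omega) (by omega)
  · obtain ⟨x, hx⟩ : ((R.children U v).filter fun x => R.children U x = ∅).Nonempty :=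
      Finset.card_pos.1 (by omega)
    obtain ⟨a, ha⟩ : ((R.children U v).filter fun x => (R.children U x).Nonempty).Nonempty :=
      Finset.card_pos.1 (by omega)
    rw [Finset.mem_filter] at hx ha
    exact hU.isReducible_of_card_children_eq_three hv hcard (by omega) hx.1 hx.2 ha.1 ha.2

end Rooting

/-- A covering design on the edges of a path, numbered along the path, all of whose members are
single edges or pairs of consecutive edges. -/
structure ChainDesign (m n : ℕ) extends Design m n where
  exists_path_eq : ∀ k, ∃ e f : Fin m, (f = e ∨ f.val = e.val + 1) ∧ path k = {e, f}
  exists_mem_path : ∀ e, ∃ k, e ∈ path k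

namespace ChainDesign

variable {R : Rooting T} {m n : ℕ}

theorem hasCovering (d : ChainDesign m n) {y : Fin m ↪ V}
    (hroot : ∀ e, y e ≠ R.root) (hy : ∀ e f : Fin m, f.val = e.val + 1 → R.parent (y f) = y e) :
    R.HasCovering (Finset.univ.map y) n := by
  classical
  have hpath : ∀ k, R.IsPathSet ((d.path k).map y) := fun k => by
    obtain ⟨e, f, hef, hk⟩ := d.exists_path_eq k
    rw [hk, Finset.map_insert, Finset.map_singleton]
    rcases hef with rfl | hef
    · simpa only [Finset.pair_eq_singleton] using Rooting.isPathSet_singleton (hroot f)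
    · rw [← hy e f hef, Finset.pair_comm]
      exact Rooting.isPathSet_pair_parent (hroot f) (hy e f hef ▸ hroot e)
  refine ⟨Fin n, inferInstance, .ofDesign d.toDesign y hpath, Fintype.card_fin n, fun z hz => ?_⟩
  obtain ⟨e, -, rfl⟩ := Finset.mem_map.1 hz
  obtain ⟨k, hk⟩ := d.exists_mem_path e
  exact ⟨_, k, rfl, Finset.mem_map_of_mem y hk⟩

/-- Four paths on three consecutive edges. -/
def three : ChainDesign 3 4 where
  path := ![{0, 1}, {1, 2}, {0}, {2}]
  color := ![true, true, false, false]
  separates := by decide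
  exists_path_eq := by decide
  exists_mem_path := by decide

/-- Five paths on four consecutive edges. -/
def four : ChainDesign 4 5 where
  path := ![{0, 1}, {1, 2}, {0}, {2, 3}, {3}]
  color := ![true, true, false, false, false]
  separates := by decide
  exists_path_eq := by decide
  exists_mem_path := by decide

/-- Six paths on five consecutive edges. -/
def five : ChainDesign 5 6 where
  path := ![{0, 1}, {1, 2}, {4}, {0}, {2, 3}, {3, 4}]
  color := ![true, true, true, false, false, false]
  separates := by decide
  exists_path_eq := by decide
  exists_mem_path := by decide

end ChainDesign

namespace Rooting

variable {R : Rooting T} {U E : Finset V}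

theorem hasCovering_of_card_le_two (hE : R.root ∉ E) (hcard : E.card ≤ 2) :
    R.HasCovering E E.card := by
  generalize hm : E.card = m at *
  obtain ⟨y, rfl⟩ := exists_embedding_map_eq hm
  let d : Design m m :=
    { path k := {k}
      color k := decide (k.val = 0)
      separates e f hef := ⟨e, f, by grind, by simp [hef, hef.symm]⟩ }
  have hpath : ∀ k, R.IsPathSet ((d.path k).map y) := fun k => by
    rw [Finset.map_singleton]
    exact isPathSet_singleton fun h => hE (h ▸ Finset.mem_map_of_mem y (Finset.mem_univ k))
  refine ⟨Fin m, inferInstance, .ofDesign d y hpath, Fintype.card_fin m, fun x hx => ?_⟩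
  obtain ⟨e, -, rfl⟩ := Finset.mem_map.1 hx
  exact ⟨_, e, rfl, Finset.mem_map_of_mem y (Finset.mem_singleton_self e)⟩

theorem IsStar.hasBichromatic_of_card_eq_three {s : Finset V} (hs : R.IsStar s)
    (hs3 : s.card = 3) : R.HasBichromatic s 4 := by
  classical
  obtain ⟨y, rfl⟩ := exists_embedding_map_eq hs3
  have hgrow : R.IsGrowable (Finset.univ.map y) (Finset.univ.map y) :=
    ⟨fun h => (hs.choose_spec _ h).1 rfl, subset_rfl, fun _ h h' => absurd h h', fun _ _ h => h⟩
  have hempty : ∀ x, R.children (Finset.univ.map y \ Finset.univ.map y) x = ∅ := by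
    simp only [Finset.sdiff_self, children, Finset.filter_empty, implies_true]
  simpa using Seed.closedThree.hasBichromatic hs hgrow (fun x _ => by rw [hempty]; exact zero_le)
    (fun e _ => hempty _) fun e he => absurd he (Finset.notMem_empty e)

theorem exists_parent_eq {r : V} (hroot : R.root ∉ U)
    (hparent : ∀ x ∈ U, R.parent x ≠ r → R.parent x ∈ U) (hU : U.Nonempty) :
    ∃ w ∈ U, R.parent w = r := by
  obtain ⟨w, hw, hmin⟩ := Finset.exists_min_image U R.depth hU
  refine ⟨w, hw, ?_⟩
  by_contra hne
  exact (R.depth_parent_lt w fun h => hroot (h ▸ hw)).not_ge (hmin _ (hparent w hw hne))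

variable [DecidableEq V]

theorem IsSubtree.hasBichromatic_of_children_root_eq (hU : R.IsSubtree U)
    (hcard : ∀ x ∈ U, (R.children U x).card ≤ 2) {w : V} (hw : R.children U R.root = {w}) :
    R.HasBichromatic U (U.card + 2) := by
  obtain ⟨hwU, hpw⟩ := mem_children.1 (hw ▸ Finset.mem_singleton_self w)
  have hgrow : R.IsGrowable U {w} := by
    refine ⟨hU.1, by simpa using hwU, fun x hx hxw => hU.2 x hx fun h => hxw ?_, fun x hx h => ?_⟩
    · rw [← hw]
      exact mem_children.2 ⟨hx, h⟩
    · rw [Finset.mem_singleton.1 hx, hpw] at h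
      exact absurd h hU.1
  obtain ⟨y, hy⟩ := exists_embedding_map_eq (Finset.card_singleton w)
  have hyw : ∀ e, y e = w := fun e =>
    Finset.mem_singleton.1 (hy ▸ Finset.mem_map_of_mem y (Finset.mem_univ e))
  have h := Seed.one.hasBichromatic (R := R) (W := U) (y := y)
    (hy ▸ ⟨w, by simp [hU.ne_root hwU]⟩) (hy ▸ hgrow)
    (fun x hx => (Finset.card_le_card
      (Finset.filter_subset_filter _ Finset.sdiff_subset)).trans (hcard x hx))
    (fun e he => absurd (Finset.mem_singleton.2 (Subsingleton.elim e 0)) he)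
    (fun e _ f => by rw [hyw, hyw, hpw]; exact (hU.ne_root hwU).symm)
  rw [hy, Finset.card_sdiff_of_subset hgrow.subset, Finset.card_singleton] at h
  have := Finset.card_pos.2 ⟨w, hwU⟩
  rwa [show U.card + 2 = 3 + (U.card - 1) by omega]

theorem exists_chain_of_card_children_le_one {r : V} (hroot : R.root ∉ U)
    (hparent : ∀ x ∈ U, R.parent x ≠ r → R.parent x ∈ U)
    (hcard : ∀ x ∈ insert r U, (R.children U x).card ≤ 1) :
    ∃ l : List V, l.Nodup ∧ l.toFinset = U ∧ (r :: l).IsChain fun x y => R.parent y = x := by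
  induction h : U.card generalizing U r with
  | zero => exact ⟨[], List.nodup_nil, (Finset.card_eq_zero.1 h).symm, List.isChain_singleton r⟩
  | succ m ih =>
    obtain ⟨w, hw, hpw⟩ := exists_parent_eq hroot hparent (Finset.card_pos.1 (by omega))
    have hparent' : ∀ x ∈ U.erase w, R.parent x ≠ w → R.parent x ∈ U.erase w := fun x hx hne => by
      obtain ⟨hxw, hxU⟩ := Finset.mem_erase.1 hx
      refine Finset.mem_erase.2 ⟨hne, hparent x hxU fun hpx => hxw ?_⟩
      exact Finset.card_le_one.1 (hcard r (Finset.mem_insert_self r U)) x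
        (mem_children.2 ⟨hxU, hpx⟩) w (mem_children.2 ⟨hw, hpw⟩)
    have hcard' : ∀ x ∈ insert w (U.erase w), (R.children (U.erase w) x).card ≤ 1 := by
      rw [Finset.insert_erase hw]
      exact fun x hx => (Finset.card_le_card (Finset.filter_subset_filter _
        (Finset.erase_subset w U))).trans (hcard x (Finset.mem_insert_of_mem hx))
    obtain ⟨l, hl, hlU, hchain⟩ := ih (fun h => hroot (Finset.mem_of_mem_erase h)) hparent' hcard'
      (by rw [Finset.card_erase_of_mem hw, h, Nat.add_sub_cancel])
    refine ⟨w :: l, hl.cons ?_, ?_, hchain.cons_cons hpw⟩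
    · rw [← List.mem_toFinset, hlU]
      exact Finset.notMem_erase w U
    · rw [List.toFinset_cons, hlU, Finset.insert_erase hw]

theorem IsSubtree.hasCovering_of_card_children_le_one (hU : R.IsSubtree U)
    (hroot : (R.children U R.root).card ≤ 1) (hcard : ∀ x ∈ U, (R.children U x).card ≤ 1)
    (h3 : 3 ≤ U.card) (h5 : U.card ≤ 5) : R.HasCovering U (U.card + 1) := by
  obtain ⟨l, hl, rfl, hchain⟩ := exists_chain_of_card_children_le_one hU.1 hU.2
    (by simpa [hroot] using hcard)
  rw [List.toFinset_card_of_nodup hl] at h3 h5 ⊢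
  let y : Fin l.length ↪ V := ⟨l.get, hl.injective_get⟩
  have hy : Finset.univ.map y = l.toFinset := by
    ext z
    simp [y, List.mem_iff_get]
  have hyroot : ∀ e, y e ≠ R.root := fun e h =>
    hU.1 (h ▸ hy ▸ Finset.mem_map_of_mem y (Finset.mem_univ e))
  have hyparent : ∀ e f : Fin l.length, f.val = e.val + 1 → R.parent (y f) = y e := by
    have h := List.isChain_iff_getElem.1 hchain.tail
    rintro ⟨i, hi⟩ ⟨j, hj⟩ rfl
    exact h i hj
  have hcovering : ∀ {n}, ChainDesign l.length n → R.HasCovering l.toFinset n := fun d =>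
    hy ▸ d.hasCovering hyroot hyparent
  clear_value y
  generalize l.length = m at *
  interval_cases m
  exacts [hcovering .three, hcovering .four, hcovering .five]

theorem IsSubtree.hasSmallCovering_of_card_children_le_two (hU : R.IsSubtree U)
    (hroot : (R.children U R.root).card ≤ 1) (hcard : ∀ x ∈ U, (R.children U x).card ≤ 2) :
    R.HasSmallCovering U := by
  rcases le_or_gt U.card 2 with h2 | h2
  · exact ⟨U.card, by omega, hasCovering_of_card_le_two hU.1 h2⟩
  rcases le_or_gt U.card 5 with h5 | h5
  · refine ⟨U.card + 1, by omega, ?_⟩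
    by_cases hbranch : ∃ v ∈ U, (R.children U v).card = 2
    · obtain ⟨v, hv, hv2⟩ := hbranch
      have hvC : v ∉ R.children U v := fun h => (hU.depth_lt_of_mem_children h).ne rfl
      have hs : insert v (R.children U v) ⊆ U :=
        Finset.insert_subset hv (Finset.filter_subset _ _)
      have hs3 : (insert v (R.children U v)).card = 3 := by
        rw [Finset.card_insert_of_notMem hvC, hv2]
      have hrest := Finset.card_sdiff_of_subset hs
      have h := (hasCovering_of_card_le_two (E := U \ insert v (R.children U v))
        (fun h => hU.1 (Finset.mem_sdiff.1 h).1) (by omega)).union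
        ((hU.isStar_insert_children hv).hasBichromatic_of_card_eq_three hs3) Finset.sdiff_disjoint
      rwa [Finset.sdiff_union_of_subset hs, hrest,
        show U.card - _ + 4 = U.card + 1 by omega] at h
    · refine hU.hasCovering_of_card_children_le_one hroot (fun x hx => ?_) h2 h5
      have := hcard x hx
      have : (R.children U x).card ≠ 2 := fun h => hbranch ⟨x, hx, h⟩
      omega
  · obtain ⟨w, hwU, hpw⟩ := exists_parent_eq hU.1 hU.2 (Finset.card_pos.1 (by omega))
    have hw : R.children U R.root = {w} := (Finset.eq_of_subset_of_card_le
      (by simp [mem_children, hwU, hpw]) (hroot.trans_eq (Finset.card_singleton w).symm)).symm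
    exact ⟨U.card + 2, by omega, (hU.hasBichromatic_of_children_root_eq hcard hw).hasCovering⟩

theorem IsSubtree.hasSmallCovering (hU : R.IsSubtree U)
    (hroot : (R.children U R.root).card ≤ 1) : R.HasSmallCovering U := by
  induction h : U.card using Nat.strong_induction_on generalizing U with
  | _ m ih =>
    by_cases hbranch : ∃ v ∈ U, 3 ≤ (R.children U v).card
    · obtain ⟨s, hs, ⟨x, hx⟩, hreduce⟩ := hU.isReducible hbranch
      refine hreduce (ih _ ?_ hU.sdiff_below ?_ rfl)
      · rw [← h]
        exact Finset.card_lt_card (Finset.sdiff_ssubset below_subset ⟨x, subset_below hs hx⟩)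
      · exact (Finset.card_le_card
          (Finset.filter_subset_filter _ Finset.sdiff_subset)).trans hroot
    · push Not at hbranch
      exact hU.hasSmallCovering_of_card_children_le_two hroot fun x hx =>
        Nat.le_of_lt_succ (hbranch x hx)

end Rooting

theorem System.exists_isRainbowSeparating {R : Rooting T} {E : Finset V} {ι : Type} [Fintype ι]
    (S : System R E ι) (hE : ∀ x ≠ R.root, x ∈ E) :
    ∃ P : Multiset T.Subgraph, T.IsRainbowSeparating 2 P ∧ P.card = Fintype.card ι := by
  have hpath : ∀ i, ∃ H : T.Subgraph, H.IsPathOf ∧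
      ∀ x ≠ R.root, R.edge x ∈ H.edgeSet ↔ x ∈ S.path i := fun i => by
    obtain ⟨hroot, u, v, p, hp, hpath⟩ := S.isPathSet i
    refine ⟨p.toSubgraph, ⟨u, v, p, hp, rfl⟩, fun x hx => ?_⟩
    rw [p.mem_edges_toSubgraph, hpath]
    refine ⟨fun ⟨y, hy, hyx⟩ => ?_, fun h => ⟨x, h, rfl⟩⟩
    exact R.edge_injOn (fun h => hroot (h ▸ hy)) hx hyx ▸ hy
  choose H hH hmem using hpath
  let q : ι → T.Subgraph × Fin 2 := fun i => (H i, if S.color i then 1 else 0)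
  refine ⟨(Finset.univ.val.map q).map Prod.fst, ⟨fun K hK => ?_, _, rfl, ?_⟩, ?_⟩
  · simp only [Multiset.map_map, Multiset.mem_map] at hK
    obtain ⟨i, -, rfl⟩ := hK
    exact hH i
  · intro e₁ he₁ e₂ he₂ hne
    obtain ⟨x, hx, rfl⟩ := R.exists_eq_of_mem_edgeSet e₁ he₁
    obtain ⟨y, hy, rfl⟩ := R.exists_eq_of_mem_edgeSet e₂ he₂
    obtain ⟨i, j, hc, hi, hj⟩ := S.separates x (hE x hx) y (hE y hy) fun h => hne (h ▸ rfl)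
    simp only [← hmem _ x hx, ← hmem _ y hy] at hi hj
    refine ⟨q i, Multiset.mem_map_of_mem q (Finset.mem_univ i), q j,
      Multiset.mem_map_of_mem q (Finset.mem_univ j), fun h => hc ?_, hi, hj⟩
    cases hci : S.color i <;> cases hcj : S.color j <;> simp_all [q]
  · rw [Multiset.card_map, Multiset.card_map]
    rfl

theorem exists_isRainbowSeparating_card_le [Fintype V] [Nontrivial V] (hT : T.IsTree) :
    ∃ P : Multiset T.Subgraph, T.IsRainbowSeparating 2 P ∧
      3 * P.card ≤ 4 * (Fintype.card V - 1) := by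
  classical
  obtain ⟨r, hr⟩ := hT.exists_vert_degree_one_of_nontrivial
  obtain ⟨R, rfl⟩ := exists_rooting hT r
  have hU : R.IsSubtree (Finset.univ.erase R.root) :=
    ⟨Finset.notMem_erase _ _, fun x _ h => Finset.mem_erase.2 ⟨h, Finset.mem_univ _⟩⟩
  have hroot : (R.children (Finset.univ.erase R.root) R.root).card ≤ 1 := by
    rw [← hr]
    refine Finset.card_le_card fun x hx => ?_
    obtain ⟨hx, hpx⟩ := Rooting.mem_children.1 hx
    rw [SimpleGraph.mem_neighborFinset]
    exact hpx ▸ R.adj_parent x (Finset.ne_of_mem_erase hx)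
  obtain ⟨n, hn, ι, _, S, rfl, -⟩ := hU.hasSmallCovering hroot
  obtain ⟨P, hP, hcard⟩ :=
    S.exists_isRainbowSeparating fun x hx => Finset.mem_erase.2 ⟨hx, Finset.mem_univ x⟩
  rw [Finset.card_erase_of_mem (Finset.mem_univ _), Finset.card_univ, ← hcard] at hn
  exact ⟨P, hP, hn⟩

end RainbowTree

theorem mainTheorem8 {V : Type*} [Fintype V] (T : SimpleGraph V) (hT : T.IsTree)
    (hn : 2 ≤ Fintype.card V) :
    ∃ c : ℕ, T.rainbowSeparationNumber 2 = (c : ℕ∞) ∧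
      (c : ℝ) ≤ 4 * ((Fintype.card V : ℝ) - 1) / 3 := by
  have : Nontrivial V := Fintype.one_lt_card_iff_nontrivial.1 hn
  obtain ⟨P, hP, hcard⟩ := RainbowTree.exists_isRainbowSeparating_card_le hT
  have hle : T.rainbowSeparationNumber 2 ≤ P.card := iInf₂_le P hP
  obtain ⟨c, hc⟩ := ENat.ne_top_iff_exists.1 (ne_top_of_le_ne_top (ENat.natCast_ne_top _) hle)
  refine ⟨c, hc.symm, ?_⟩
  rw [← hc, Nat.cast_le] at hle
  have hbound : (3 * c + 4 : ℝ) ≤ 4 * Fintype.card V := by exact_mod_cast (by omega)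
  linarith
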